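/- Let $0<\beta<1/2$, $0\le\theta\le 1$, and let $m\ge 0$ be an integer. For a function $w$ on $(0,1)$ put $${}_0I_x^\beta w(x)=\frac1{\Gamma(\beta)}\int_0^x\frac{w(s)}{(x-s)^{1-\beta}}\,ds,\qquad {}_xI_1^\beta w(x)=\frac1{\Gamma(\beta)}\int_x^1\frac{w(s)}{(s-x)^{1-\beta}}\,ds,$$ $$I^\beta_\theta w=\theta\,{}_0I_x^\beta w+(1-\theta)\,{}_xI_1^\beta w .$$ Write ${}_0I_1^\beta w$ for the value of ${}_0I_x^\beta w$ at $x=1$ and also, with left superscript $r$, ${}^r_0I_1^\beta w$ for the value of ${}_xI_1^\beta w$ at $x=0$. For $\mu>0$ let $H^\mu_0(0,1)$ be the completion of $C_0^\infty(0,1)$ in the norm of $H^\mu(\mathbb R)$; let $D$ denote the weak derivative on $(0,1)$. Let $K\in C^{m+1}[0,1]$ with $0<K_m\le K(x)\le K_M<\infty$ on $(0,1)$, and set $w_l(x)=\bigl(\int_0^1\frac{ds}{K(s)}\bigr)^{-1}\int_x^1\frac{ds}{K(s)}$. Let $u_l\in H^{1-\beta}_0(0,1)$ be the solution of $$I^\beta_\theta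 u_l-(1-\theta)\bigl({}^r_0I_1^\beta u_l\bigr)(1-x)-\theta\bigl({}_0I_1^\beta u_l\bigr)x=w_l-(1-x),\qquad 0\le x\le 1,$$ and assume that $$1+\theta\,{}_0I_1^\beta u_l-(1-\theta)\,{}^r_0I_1^\beta u_l\ne 0 .$$ Then there is a constant $C>0$, depending only on $\beta,\theta,m$ and $K$, such that the following holds for every $f\in H^m(0,1)$ and every weak solution $u$ of $-D(K\,D I^\beta_\theta u)=f$, $u(0)=u(1)=0$, that is, every $u\in H^{1-\beta}_0(0,1)$ with $$\int_0^1 K\,(D I^\beta_\theta u)\,(Dv)\,dx=\int_0^1 f\,v\,dx\qquad\text{for all } v\in H^1_0(0,1).$$ One has $I^\beta_\theta u\in H^{m+2}(0,1)$ and $$\|I^\beta_\theta u\|_{H^{m+2}(0,1)}\le C\bigl(\|K\|_{C^{m+1}[0,1]}+\|f\|_{H^m(0,1)}\bigr).$$ In particular, the derivative $D^{m+2}I^\beta_\theta u$ exists as a weak derivative in $L^2(0,1)$, and its $L^2(0,1)$ norm is bounded by the same right-hand side. -/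

import Mathlib

open MeasureTheory Set Filter Topology
open scoped ContDiff FourierTransform

noncomputable section

namespace FracDiff

/-! Real functions on `(0,1)` are represented by total functions `ℝ → ℝ`; only their values
in `(0,1)` matter (in `[0,1]` for the coefficient `K`), and up to null sets for elements of
Lebesgue and Sobolev spaces. -/

/-- Lebesgue measure on `(0,1)`. -/
def vol01 : Measure ℝ := volume.restrict (Ioo 0 1)

/-- `φ ∈ C₀^∞(0,1)` (extended by zero to `ℝ`). -/
def IsTest (φ : ℝ → ℝ) : Prop :=
  ContDiff ℝ ∞ φ ∧ HasCompactSupport φ ∧ tsupport φ ⊆ Ioo 0 1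

/-- `g` is the weak derivative of order `k` of `w` on `(0,1)`. -/
def HasWeakDeriv (k : ℕ) (w g : ℝ → ℝ) : Prop :=
  LocallyIntegrableOn w (Ioo 0 1) ∧ LocallyIntegrableOn g (Ioo 0 1) ∧
    ∀ φ : ℝ → ℝ, IsTest φ →
      ∫ x in Ioo (0 : ℝ) 1, w x * iteratedDeriv k φ x =
        (-1) ^ k * ∫ x in Ioo (0 : ℝ) 1, g x * φ x

open Classical in
/-- The weak derivative `D^k w` on `(0,1)` (unique up to null sets; `0` if there is none). -/
def weakDeriv (k : ℕ) (w : ℝ → ℝ) : ℝ → ℝ :=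
  if h : ∃ g, HasWeakDeriv k w g then h.choose else 0

/-- `‖w‖_{L²(0,1)}` for `w ∈ L²(0,1)`. -/
def l2Norm (w : ℝ → ℝ) : ℝ := √(∫ x in Ioo (0 : ℝ) 1, (w x) ^ 2)

/-- `w ∈ H^m(0,1)`: all weak derivatives of order at most `m` exist and are in `L²(0,1)`. -/
def MemH (m : ℕ) (w : ℝ → ℝ) : Prop :=
  ∀ k ≤ m, ∃ g, HasWeakDeriv k w g ∧ MemLp g 2 vol01

/-- `‖w‖_{H^m(0,1)}` for `w ∈ H^m(0,1)`. -/
def hNorm (m : ℕ) (w : ℝ → ℝ) : ℝ :=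
  √(∑ k ∈ Finset.range (m + 1), (l2Norm (weakDeriv k w)) ^ 2)

/-- `‖K‖_{C^n[0,1]}` for `K ∈ C^n[0,1]`. -/
def cNorm (n : ℕ) (K : ℝ → ℝ) : ℝ :=
  ∑ k ∈ Finset.range (n + 1),
    ⨆ x : Icc (0 : ℝ) 1, |iteratedDerivWithin k K (Icc 0 1) x|

/-- `‖φ‖_{H^μ(ℝ)}` for `φ ∈ C₀^∞(ℝ)`, with `ω = 2πξ` as the frequency variable. -/
def fracNorm (μ : ℝ) (φ : ℝ → ℝ) : ℝ :=
  √((∫ x : ℝ, (φ x) ^ 2) +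
    ∫ ξ : ℝ, ((2 * Real.pi * |ξ|) ^ μ * ‖𝓕 (fun x : ℝ => (φ x : ℂ)) ξ‖) ^ 2)

/-- `w ∈ H^μ_0(0,1)`, the completion of `C₀^∞(0,1)` in the norm of `H^μ(ℝ)`, realised inside
`L²(0,1)`: `w` is the `L²`-limit of a sequence of test functions that is Cauchy in the norm of
`H^μ(ℝ)`. -/
def MemH0 (μ : ℝ) (w : ℝ → ℝ) : Prop :=
  MemLp w 2 vol01 ∧ ∃ φ : ℕ → ℝ → ℝ, (∀ n, IsTest (φ n)) ∧
    (∀ ε > 0, ∃ N, ∀ i ≥ N, ∀ j ≥ N, fracNorm μ (fun x => φ i x - φ j x) < ε) ∧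
    Tendsto (fun n => l2Norm (fun x => φ n x - w x)) atTop (𝓝 0)

/-- The left fractional integral of order `σ` on `(0,1)`, from `0` to `x`. -/
def leftI (σ : ℝ) (w : ℝ → ℝ) (x : ℝ) : ℝ :=
  1 / Real.Gamma σ * ∫ s in (0 : ℝ)..x, w s / (x - s) ^ (1 - σ)

/-- The right fractional integral of order `σ` on `(0,1)`, from `x` to `1`. -/
def rightI (σ : ℝ) (w : ℝ → ℝ) (x : ℝ) : ℝ :=
  1 / Real.Gamma σ * ∫ s in x..(1 : ℝ), w s / (s - x) ^ (1 - σ)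

/-- The two-sided fractional integral `I^β_θ`. -/
def iTheta (β θ : ℝ) (w : ℝ → ℝ) (x : ℝ) : ℝ :=
  θ * leftI β w x + (1 - θ) * rightI β w x

/-- `u ∈ H^{1-β}_0(0,1)` is a weak solution of `-D(K D I^β_θ u) = f`, `u(0) = u(1) = 0`, in the
Petrov-Galerkin sense, for `f ∈ L²(0,1)`:
`(K D I^β_θ u, Dv)_{L²} = (f, v)_{L²}` for all `v ∈ H^1_0(0,1)`. -/
def IsWeakSolution (β θ : ℝ) (K f u : ℝ → ℝ) : Prop :=
  MemH0 (1 - β) u ∧ ∀ v : ℝ → ℝ, MemH0 1 v →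
    ∫ x in Ioo (0 : ℝ) 1, K x * weakDeriv 1 (iTheta β θ u) x * weakDeriv 1 v x =
      ∫ x in Ioo (0 : ℝ) 1, f x * v x

/-- The solution `w_l` of `(K w_l')' = 0`, `w_l(0) = 1`, `w_l(1) = 0`. -/
def wl (K : ℝ → ℝ) (x : ℝ) : ℝ :=
  (∫ s in (0 : ℝ)..1, 1 / K s)⁻¹ * ∫ s in x..(1 : ℝ), 1 / K s

/-- `p` is the function `u_l ∈ H^{1-β}_0(0,1)` attached to `K`: on `[0,1]`,
`I^β_θ p - (1-θ) (rightI p)(0) (1-x) - θ (leftI p)(1) x = w_l - (1-x)`. -/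
def IsUl (β θ : ℝ) (K p : ℝ → ℝ) : Prop :=
  MemH0 (1 - β) p ∧ ∀ x ∈ Icc (0 : ℝ) 1,
    iTheta β θ p x - (1 - θ) * rightI β p 0 * (1 - x) - θ * leftI β p 1 * x =
      wl K x - (1 - x)

/-- The solvability condition `1 + θ (leftI u_l)(1) - (1-θ) (rightI u_l)(0) ≠ 0`. -/
def SolvCond (β θ : ℝ) (K : ℝ → ℝ) : Prop :=
  ∀ p : ℝ → ℝ, IsUl β θ K p → 1 + θ * leftI β p 1 - (1 - θ) * rightI β p 0 ≠ 0

end FracDiff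

end

open FracDiff

/-! For `w` extended by zero, `I^β_θ w` is the restriction to `(0,1)` of a convolution with an
integrable kernel whose Fourier transform is bounded by a multiple of `|ξ|^(-β)`; hence `I^β_θ`
maps `H^{1-β}_0(0,1)` into `H^1(0,1)`, and identities for test functions pass to the limit.

The remaining difficulty is to control constants of integration. The adjoint of `I^β_θ` maps the
weight `ρ(x) = x^a (1-x)^b` with `a + b = -β` to a constant, for exponents found by the
intermediate value theorem. Hence `D I^β_θ φ = I^β_θ φ'` has zero `ρ`-mean, and the commutator of
`I^β_θ` with the Euler operator `x D` expresses the `ρ`-mean of `I^β_θ φ` through `D I^β_θ φ`. The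
first identity fixes the constant `κ` in the flux `K D I^β_θ u = κ - ∫ f`, the second fixes the
constant in `I^β_θ u` itself, both in terms of `‖f‖_{L²}`. Regularity follows from
`D I^β_θ u = K⁻¹ (κ - ∫ f)`, since multiplication by a `C^{m+1}` function is bounded on
`H^{m+1}(0,1)`.
-/

namespace FracDiff

/-! ### Weak derivatives on the unit interval -/

section WeakDerivative

variable {φ ψ w w' g g' : ℝ → ℝ} {k : ℕ}

namespace IsTest

lemma eq_zero (h : IsTest φ) {x : ℝ} (hx : x ∉ Ioo (0 : ℝ) 1) : φ x = 0 :=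
  image_eq_zero_of_notMem_tsupport fun h' => hx (h.2.2 h')

lemma continuous (h : IsTest φ) : Continuous φ := h.1.continuous

lemma differentiable (h : IsTest φ) : Differentiable ℝ φ := h.1.differentiable (by simp)

lemma integrable (h : IsTest φ) : Integrable φ :=
  h.continuous.integrable_of_hasCompactSupport h.2.1

protected lemma deriv (h : IsTest φ) : IsTest (deriv φ) :=
  ⟨(contDiff_infty_iff_deriv.1 h.1).2, h.2.1.deriv, tsupport_deriv_subset.trans h.2.2⟩

protected lemma iteratedDeriv (h : IsTest φ) (k : ℕ) : IsTest (iteratedDeriv k φ) := by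
  induction k with
  | zero => simpa only [iteratedDeriv_zero] using h
  | succ n ih => rw [iteratedDeriv_succ]; exact ih.deriv

lemma sub (h : IsTest φ) (h' : IsTest ψ) : IsTest (fun x => φ x - ψ x) :=
  ⟨h.1.sub h'.1, h.2.1.sub h'.2.1, (tsupport_sub φ ψ).trans (union_subset h.2.2 h'.2.2)⟩

lemma contDiff_mul {r : ℝ → ℝ} (h : IsTest φ) (hr : ContDiff ℝ ∞ r) :
    IsTest (fun x => r x * φ x) :=
  ⟨hr.mul h.1, h.2.1.mul_left, tsupport_mul_subset_right.trans h.2.2⟩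

lemma setIntegral_eq (h : IsTest φ) : ∫ x in Ioo (0 : ℝ) 1, φ x = ∫ x, φ x :=
  setIntegral_eq_integral_of_forall_compl_eq_zero fun _ hx => h.eq_zero hx

lemma setIntegral_mul_eq (h : IsTest φ) (w : ℝ → ℝ) :
    ∫ x in Ioo (0 : ℝ) 1, w x * φ x = ∫ x, w x * φ x :=
  setIntegral_eq_integral_of_forall_compl_eq_zero fun _ hx => by rw [h.eq_zero hx, mul_zero]

lemma integrable_mul (h : IsTest φ) (hw : LocallyIntegrableOn w (Ioo 0 1)) :
    Integrable (fun x => w x * φ x) := by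
  have hsupp : IntegrableOn (fun x => w x * φ x) (tsupport φ) :=
    (hw.integrableOn_compact_subset h.2.2 h.2.1).mul_continuousOn h.continuous.continuousOn h.2.1
  refine (integrableOn_iff_integrable_of_support_subset fun x hx => ?_).1 hsupp
  exact subset_tsupport _ (right_ne_zero_of_mul (Function.mem_support.1 hx))

lemma exists_abs_le (h : IsTest φ) : ∃ C, ∀ x, |φ x| ≤ C :=
  h.continuous.bounded_above_of_compact_support h.2.1

end IsTest

lemma ae_eq_of_forall_test (hw : LocallyIntegrableOn w (Ioo 0 1))
    (hw' : LocallyIntegrableOn w' (Ioo 0 1))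
    (h : ∀ φ, IsTest φ → ∫ x in Ioo (0 : ℝ) 1, w x * φ x = ∫ x in Ioo (0 : ℝ) 1, w' x * φ x) :
    w =ᵐ[vol01] w' := by
  have hzero := isOpen_Ioo.ae_eq_zero_of_integral_contDiff_smul_eq_zero (μ := volume) (hw.sub hw')
    fun φ h1 h2 h3 => by
      have hφ : IsTest φ := ⟨h1, h2, h3⟩
      have hsub : ∀ x, φ x • (w - w') x = w x * φ x - w' x * φ x := fun x => by
        rw [smul_eq_mul, Pi.sub_apply]; ring
      simp_rw [hsub]
      rw [integral_sub (hφ.integrable_mul hw) (hφ.integrable_mul hw'), ← hφ.setIntegral_mul_eq,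
        ← hφ.setIntegral_mul_eq, h φ hφ, sub_self]
  refine (ae_restrict_iff' measurableSet_Ioo).2 ?_
  filter_upwards [hzero] with x hx hx01
  exact sub_eq_zero.1 (hx hx01)

lemma locallyIntegrableOn_congr (hw : LocallyIntegrableOn w (Ioo 0 1)) (h : w =ᵐ[vol01] w') :
    LocallyIntegrableOn w' (Ioo 0 1) := by
  rw [locallyIntegrableOn_iff isOpen_Ioo.isLocallyClosed] at hw ⊢
  exact fun s hs hc => (hw s hs hc).congr_fun_ae (ae_restrict_of_ae_restrict_of_subset hs h)

namespace HasWeakDeriv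

lemma ae_unique (h : HasWeakDeriv k w g) (h' : HasWeakDeriv k w g') : g =ᵐ[vol01] g' :=
  ae_eq_of_forall_test h.2.1 h'.2.1 fun φ hφ =>
    mul_left_cancel₀ (pow_ne_zero k (neg_ne_zero.2 one_ne_zero))
      ((h.2.2 φ hφ).symm.trans (h'.2.2 φ hφ))

lemma congr (h : HasWeakDeriv k w g) (hw : w =ᵐ[vol01] w') (hg : g =ᵐ[vol01] g') :
    HasWeakDeriv k w' g' := by
  refine ⟨locallyIntegrableOn_congr h.1 hw, locallyIntegrableOn_congr h.2.1 hg, fun φ hφ => ?_⟩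
  have hwφ : ∫ x in Ioo (0 : ℝ) 1, w' x * iteratedDeriv k φ x =
      ∫ x in Ioo (0 : ℝ) 1, w x * iteratedDeriv k φ x :=
    integral_congr_ae (by filter_upwards [hw] with x hx; rw [hx])
  have hgφ : ∫ x in Ioo (0 : ℝ) 1, g' x * φ x = ∫ x in Ioo (0 : ℝ) 1, g x * φ x :=
    integral_congr_ae (by filter_upwards [hg] with x hx; rw [hx])
  rw [hwφ, hgφ, h.2.2 φ hφ]

protected lemma weakDeriv (h : HasWeakDeriv k w g) : HasWeakDeriv k w (weakDeriv k w) := by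
  have hex : ∃ g, HasWeakDeriv k w g := ⟨g, h⟩
  rw [weakDeriv, dif_pos hex]
  exact hex.choose_spec

lemma weakDeriv_ae_eq (h : HasWeakDeriv k w g) : weakDeriv k w =ᵐ[vol01] g :=
  h.weakDeriv.ae_unique h

protected lemma zero (h : LocallyIntegrableOn w (Ioo 0 1)) : HasWeakDeriv 0 w w :=
  ⟨h, h, fun φ _ => by rw [iteratedDeriv_zero, pow_zero, one_mul]⟩

lemma succ (h : HasWeakDeriv 1 w g) (h' : HasWeakDeriv k g g') : HasWeakDeriv (k + 1) w g' := by
  refine ⟨h.1, h'.2.1, fun φ hφ => ?_⟩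
  have hφk := h.2.2 _ (hφ.iteratedDeriv k)
  rw [iteratedDeriv_one, pow_one] at hφk
  rw [iteratedDeriv_succ, hφk, h'.2.2 φ hφ]
  ring

lemma of_succ (h : HasWeakDeriv 1 w g) (h' : HasWeakDeriv (k + 1) w g') :
    HasWeakDeriv k g g' := by
  refine ⟨h.2.1, h'.2.1, fun φ hφ => ?_⟩
  have hφk := h.2.2 _ (hφ.iteratedDeriv k)
  rw [iteratedDeriv_one, ← iteratedDeriv_succ, h'.2.2 φ hφ] at hφk
  linear_combination hφk

lemma add (h : HasWeakDeriv k w g) (h' : HasWeakDeriv k w' g') :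
    HasWeakDeriv k (fun x => w x + w' x) (fun x => g x + g' x) := by
  refine ⟨h.1.add h'.1, h.2.1.add h'.2.1, fun φ hφ => ?_⟩
  have hφk := hφ.iteratedDeriv k
  simp_rw [add_mul]
  rw [integral_add (hφk.integrable_mul h.1).integrableOn (hφk.integrable_mul h'.1).integrableOn,
    integral_add (hφ.integrable_mul h.2.1).integrableOn (hφ.integrable_mul h'.2.1).integrableOn,
    h.2.2 φ hφ, h'.2.2 φ hφ, mul_add]

lemma neg (h : HasWeakDeriv k w g) : HasWeakDeriv k (fun x => -w x) (fun x => -g x) := by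
  refine ⟨h.1.neg, h.2.1.neg, fun φ hφ => ?_⟩
  simp_rw [neg_mul, integral_neg, h.2.2 φ hφ, mul_neg]

lemma sub (h : HasWeakDeriv k w g) (h' : HasWeakDeriv k w' g') :
    HasWeakDeriv k (fun x => w x - w' x) (fun x => g x - g' x) := by
  simpa only [sub_eq_add_neg] using h.add h'.neg

end HasWeakDeriv

lemma exists_isTest_integral_eq_one : ∃ η : ℝ → ℝ, IsTest η ∧ ∫ x, η x = 1 := by
  let b : ContDiffBump (1 / 2 : ℝ) := ⟨1 / 8, 1 / 4, by norm_num, by norm_num⟩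
  refine ⟨b.normed volume, ⟨b.contDiff_normed, b.hasCompactSupport_normed, ?_⟩, b.integral_normed⟩
  rw [b.tsupport_normed_eq, Real.closedBall_eq_Icc]
  refine Icc_subset_Ioo ?_ ?_ <;> norm_num [b]

lemma IsTest.exists_eq_zero_of_notMem_Icc (h : IsTest φ) :
    ∃ a b : ℝ, 0 < a ∧ b < 1 ∧ ∀ x ∉ Icc a b, φ x = 0 := by
  rcases (tsupport φ).eq_empty_or_nonempty with hempty | hne
  · refine ⟨1, 0, one_pos, one_pos, fun x _ => image_eq_zero_of_notMem_tsupport ?_⟩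
    rw [hempty]
    exact notMem_empty x
  · obtain ⟨a, ha, hle⟩ := h.2.1.exists_isLeast hne
    obtain ⟨b, hb, hge⟩ := h.2.1.exists_isGreatest hne
    exact ⟨a, b, (h.2.2 ha).1, (h.2.2 hb).2, fun x hx =>
      image_eq_zero_of_notMem_tsupport fun hx' => hx ⟨hle hx', hge hx'⟩⟩

lemma IsTest.exists_deriv_eq (h : IsTest φ) (h0 : ∫ x, φ x = 0) :
    ∃ ψ, IsTest ψ ∧ deriv ψ = φ := by
  have hderiv : ∀ x, HasDerivAt (fun x => ∫ s in (0 : ℝ)..x, φ s) (φ x) x := fun x =>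
    h.continuous.integral_hasStrictDerivAt 0 x |>.hasDerivAt
  have hderiv' : deriv (fun x => ∫ s in (0 : ℝ)..x, φ s) = φ := funext fun x => (hderiv x).deriv
  obtain ⟨a, b, ha, hb, hφ⟩ := h.exists_eq_zero_of_notMem_Icc
  have hleft : ∀ x < a, ∫ s in (0 : ℝ)..x, φ s = 0 := fun x hx =>
    intervalIntegral.integral_zero_ae <| ae_of_all _ fun s hs => hφ s fun hs' =>
      (lt_of_lt_of_le (max_lt ha hx) hs'.1).not_ge hs.2
  have hright : ∀ x, 0 ≤ x → b < x → ∫ s in (0 : ℝ)..x, φ s = 0 := fun x hx0 hx => by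
    rw [intervalIntegral.integral_of_le hx0]
    refine (setIntegral_eq_integral_of_forall_compl_eq_zero fun s hs => hφ s fun hs' => ?_).trans h0
    exact hs ⟨ha.trans_le hs'.1, hs'.2.trans hx.le⟩
  have hsupp : Function.support (fun x => ∫ s in (0 : ℝ)..x, φ s) ⊆ Icc a b := fun x hx => by
    have hax : a ≤ x := not_lt.1 fun hlt => hx (hleft x hlt)
    exact ⟨hax, not_lt.1 fun hlt => hx (hright x (ha.le.trans hax) hlt)⟩
  refine ⟨_, ⟨?_, ?_, ?_⟩, hderiv'⟩
  · exact contDiff_infty_iff_deriv.2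
      ⟨fun x => (hderiv x).differentiableAt, by rw [hderiv']; exact h.1⟩
  · exact HasCompactSupport.of_support_subset_isCompact isCompact_Icc hsupp
  · exact (closure_minimal hsupp isClosed_Icc).trans (Icc_subset_Ioo ha hb)

lemma HasWeakDeriv.ae_const (h : HasWeakDeriv 1 w 0) : ∃ c : ℝ, w =ᵐ[vol01] fun _ => c := by
  obtain ⟨η, hη, hη1⟩ := exists_isTest_integral_eq_one
  refine ⟨∫ x in Ioo (0 : ℝ) 1, w x * η x, ae_eq_of_forall_test h.1
    (continuousOn_const.locallyIntegrableOn measurableSet_Ioo) fun φ hφ => ?_⟩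
  have hη' : IsTest (fun x => (∫ x, φ x) * η x) := hη.contDiff_mul contDiff_const
  have hmean : ∫ x, (φ x - (∫ x, φ x) * η x) = 0 := by
    rw [integral_sub hφ.integrable hη'.integrable, integral_const_mul, hη1, mul_one, sub_self]
  obtain ⟨ψ, hψ, hψ'⟩ := (hφ.sub hη').exists_deriv_eq hmean
  have hpair : ∫ x in Ioo (0 : ℝ) 1, w x * (φ x - (∫ x, φ x) * η x) = 0 := by
    simpa [iteratedDeriv_one, hψ'] using h.2.2 ψ hψ
  have hexpand : ∀ x, w x * (φ x - (∫ x, φ x) * η x) = w x * φ x - (∫ x, φ x) * (w x * η x) :=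
    fun x => by ring
  simp_rw [hexpand] at hpair
  rw [integral_sub (hφ.integrable_mul h.1).integrableOn
    ((hη.integrable_mul h.1).const_mul _).integrableOn, integral_const_mul] at hpair
  rw [integral_const_mul, hφ.setIntegral_eq]
  linarith

lemma setIntegral_Ioo_eq (f : ℝ → ℝ) :
    ∫ x in Ioo (0 : ℝ) 1, f x = ∫ x in (0 : ℝ)..1, f x := by
  rw [intervalIntegral.integral_of_le zero_le_one, integral_Ioc_eq_integral_Ioo]

lemma intervalIntegrable_zero_one_iff :
    IntervalIntegrable g volume 0 1 ↔ IntegrableOn g (Ioo 0 1) :=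
  intervalIntegrable_iff_integrableOn_Ioo_of_le zero_le_one

lemma hasWeakDeriv_of_absolutelyContinuousOnInterval
    (hw : AbsolutelyContinuousOnInterval w 0 1) : HasWeakDeriv 1 w (deriv w) := by
  refine ⟨(intervalIntegrable_zero_one_iff.1
    hw.continuousOn.intervalIntegrable).locallyIntegrableOn,
    (intervalIntegrable_zero_one_iff.1 hw.intervalIntegrable_deriv).locallyIntegrableOn,
    fun φ hφ => ?_⟩
  have hac : AbsolutelyContinuousOnInterval φ 0 1 :=
    (hφ.1.of_le (by simp)).contDiffOn.absolutelyContinuousOnInterval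
  rw [setIntegral_Ioo_eq, setIntegral_Ioo_eq, iteratedDeriv_one,
    hw.integral_mul_deriv_eq_deriv_mul hac, hφ.eq_zero (x := 0) (by simp),
    hφ.eq_zero (x := 1) (by simp)]
  ring

lemma absolutelyContinuousOnInterval_primitive (hg : IntegrableOn g (Ioo 0 1)) (c : ℝ) :
    AbsolutelyContinuousOnInterval (fun x => c + ∫ s in (0 : ℝ)..x, g s) 0 1 := by
  have hconst : AbsolutelyContinuousOnInterval (fun _ : ℝ => c) 0 1 :=
    contDiffOn_const.absolutelyContinuousOnInterval
  exact hconst.add ((intervalIntegrable_zero_one_iff.2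
    hg).absolutelyContinuousOnInterval_intervalIntegral left_mem_uIcc)

lemma deriv_primitive_ae_eq (hg : IntegrableOn g (Ioo 0 1)) (c : ℝ) :
    deriv (fun x => c + ∫ s in (0 : ℝ)..x, g s) =ᵐ[vol01] g := by
  refine (ae_restrict_iff' measurableSet_Ioo).2 ?_
  filter_upwards [(intervalIntegrable_zero_one_iff.2 hg).ae_hasDerivAt_integral] with x hx hx01
  have hx' := hx (by rw [uIcc_of_le zero_le_one]; exact Ioo_subset_Icc_self hx01) 0 left_mem_uIcc
  exact (hx'.const_add c).deriv

lemma hasWeakDeriv_primitive (hg : IntegrableOn g (Ioo 0 1)) (c : ℝ) :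
    HasWeakDeriv 1 (fun x => c + ∫ s in (0 : ℝ)..x, g s) g :=
  (hasWeakDeriv_of_absolutelyContinuousOnInterval
    (absolutelyContinuousOnInterval_primitive hg c)).congr (ae_eq_refl _)
      (deriv_primitive_ae_eq hg c)

lemma HasWeakDeriv.exists_ae_eq_primitive (h : HasWeakDeriv 1 w g)
    (hg : IntegrableOn g (Ioo 0 1)) :
    ∃ c : ℝ, w =ᵐ[vol01] fun x => c + ∫ s in (0 : ℝ)..x, g s := by
  have hdiff := h.sub (hasWeakDeriv_primitive hg 0)
  obtain ⟨c, hc⟩ := (hdiff.congr (g' := 0) (ae_eq_refl _)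
    (ae_of_all _ fun x => sub_self (g x))).ae_const
  refine ⟨c, ?_⟩
  filter_upwards [hc] with x hx
  linarith

lemma tendsto_integral_mul_of_tendsto_L1 {α : Type*} [MeasurableSpace α] {μ : Measure α}
    {f : ℕ → α → ℝ} {f₀ b : α → ℝ} {C : ℝ} (hf : ∀ n, Integrable (f n) μ)
    (hf₀ : Integrable f₀ μ) (hb : AEStronglyMeasurable b μ) (hC : ∀ᵐ x ∂μ, |b x| ≤ C)
    (h : Tendsto (fun n => ∫ x, |f n x - f₀ x| ∂μ) atTop (𝓝 0)) :
    Tendsto (fun n => ∫ x, f n x * b x ∂μ) atTop (𝓝 (∫ x, f₀ x * b x ∂μ)) := by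
  rw [tendsto_iff_norm_sub_tendsto_zero]
  refine squeeze_zero (fun _ => norm_nonneg _) (fun n => ?_) (by simpa using h.mul_const C)
  rw [← integral_sub ((hf n).mul_bdd hb hC) (hf₀.mul_bdd hb hC), ← integral_mul_const]
  refine abs_integral_le_integral_abs.trans (integral_mono_of_nonneg
    (ae_of_all _ fun x => abs_nonneg _) (((hf n).sub hf₀).abs.mul_const _) ?_)
  filter_upwards [hC] with x hx
  rw [← sub_mul, abs_mul]
  exact mul_le_mul_of_nonneg_left hx (abs_nonneg _)

lemma HasWeakDeriv.of_tendsto_L1 {wn gn : ℕ → ℝ → ℝ} (h : ∀ n, HasWeakDeriv k (wn n) (gn n))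
    (hwn : ∀ n, IntegrableOn (wn n) (Ioo 0 1)) (hgn : ∀ n, IntegrableOn (gn n) (Ioo 0 1))
    (hw : IntegrableOn w (Ioo 0 1)) (hg : IntegrableOn g (Ioo 0 1))
    (hwlim : Tendsto (fun n => ∫ x in Ioo (0 : ℝ) 1, |wn n x - w x|) atTop (𝓝 0))
    (hglim : Tendsto (fun n => ∫ x in Ioo (0 : ℝ) 1, |gn n x - g x|) atTop (𝓝 0)) :
    HasWeakDeriv k w g := by
  refine ⟨hw.locallyIntegrableOn, hg.locallyIntegrableOn, fun φ hφ => ?_⟩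
  have hφk := hφ.iteratedDeriv k
  obtain ⟨C, hC⟩ := hφ.exists_abs_le
  obtain ⟨C', hC'⟩ := hφk.exists_abs_le
  have hleft := tendsto_integral_mul_of_tendsto_L1 hwn hw
    hφk.continuous.aestronglyMeasurable (ae_of_all _ hC') hwlim
  have hright := tendsto_integral_mul_of_tendsto_L1 hgn hg
    hφ.continuous.aestronglyMeasurable (ae_of_all _ hC) hglim
  refine tendsto_nhds_unique hleft ?_
  simp_rw [fun n => (h n).2.2 φ hφ]
  exact hright.const_mul _

end WeakDerivative

/-! ### The space `L²(0,1)` and Sobolev estimates -/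

section LebesgueSpace

variable {w w' g R : ℝ → ℝ} {C : ℝ}

instance instIsProbabilityMeasureVol01 : IsProbabilityMeasure vol01 := ⟨by simp [vol01]⟩

lemma integrableOn_of_memLp (h : MemLp w 2 vol01) : IntegrableOn w (Ioo 0 1) :=
  h.integrable one_le_two

lemma l2Norm_nonneg (w : ℝ → ℝ) : 0 ≤ l2Norm w := Real.sqrt_nonneg _

lemma l2Norm_neg (w : ℝ → ℝ) : l2Norm (fun x => -w x) = l2Norm w := by
  simp only [l2Norm, neg_sq]

lemma l2Norm_abs (w : ℝ → ℝ) : l2Norm (fun x => |w x|) = l2Norm w := by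
  simp only [l2Norm, sq_abs]

lemma l2Norm_congr (h : w =ᵐ[vol01] w') : l2Norm w = l2Norm w' :=
  congrArg Real.sqrt (integral_congr_ae (h.fun_comp (· ^ 2)))

lemma l2Norm_eq_eLpNorm (h : MemLp w 2 vol01) : l2Norm w = (eLpNorm w 2 vol01).toReal := by
  rw [h.eLpNorm_eq_integral_rpow_norm (by norm_num) (by norm_num), ENNReal.toReal_ofReal
    (by positivity), l2Norm, Real.sqrt_eq_rpow, ← vol01]
  simp

lemma l2Norm_add_le (h : MemLp w 2 vol01) (h' : MemLp w' 2 vol01) :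
    l2Norm (fun x => w x + w' x) ≤ l2Norm w + l2Norm w' := by
  have hadd : MemLp (fun x => w x + w' x) 2 vol01 := h.add h'
  rw [l2Norm_eq_eLpNorm h, l2Norm_eq_eLpNorm h', l2Norm_eq_eLpNorm hadd,
    ← ENNReal.toReal_add h.eLpNorm_ne_top h'.eLpNorm_ne_top]
  exact ENNReal.toReal_mono (ENNReal.add_ne_top.2 ⟨h.eLpNorm_ne_top, h'.eLpNorm_ne_top⟩)
    (eLpNorm_add_le h.1 h'.1 one_le_two)

lemma l2Norm_le_of_ae_abs_le (hC0 : 0 ≤ C) (hC : ∀ᵐ x ∂vol01, |w x| ≤ C) : l2Norm w ≤ C := by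
  refine Real.sqrt_le_iff.2 ⟨hC0, ?_⟩
  have hint : ∫ x, w x ^ 2 ∂vol01 ≤ ∫ _, C ^ 2 ∂vol01 := by
    refine integral_mono_of_nonneg (ae_of_all _ fun x => sq_nonneg _) (integrable_const _) ?_
    filter_upwards [hC] with x hx
    exact sq_le_sq' (abs_le.1 hx).1 (abs_le.1 hx).2
  rwa [integral_const, probReal_univ, one_smul] at hint

lemma abs_integral_mul_le_l2Norm_mul (h : MemLp w 2 vol01) (h' : MemLp w' 2 vol01) :
    |∫ x in Ioo (0 : ℝ) 1, w x * w' x| ≤ l2Norm w * l2Norm w' := by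
  have hhölder := integral_mul_norm_le_Lp_mul_Lq (μ := vol01) (f := w) (g := w')
    Real.HolderConjugate.two_two (by simpa using h) (by simpa using h')
  rw [l2Norm, l2Norm, Real.sqrt_eq_rpow, Real.sqrt_eq_rpow, ← vol01]
  refine abs_integral_le_integral_abs.trans ?_
  simpa [abs_mul] using hhölder

lemma integral_abs_le_l2Norm (h : MemLp w 2 vol01) : ∫ x in Ioo (0 : ℝ) 1, |w x| ≤ l2Norm w := by
  have hone : l2Norm (fun _ => (1 : ℝ)) = 1 := by simp [l2Norm]
  have hCS := abs_integral_mul_le_l2Norm_mul (w := fun x => |w x|) h.abs (memLp_const (1 : ℝ))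
  simp only [mul_one, hone, l2Norm_abs] at hCS
  exact (le_abs_self _).trans hCS

lemma abs_primitive_le_l2Norm (h : MemLp w 2 vol01) {x : ℝ} (hx : x ∈ Ioo (0 : ℝ) 1) :
    |∫ s in (0 : ℝ)..x, w s| ≤ l2Norm w := by
  refine le_trans ?_ (integral_abs_le_l2Norm h)
  refine (intervalIntegral.abs_integral_le_integral_abs hx.1.le).trans ?_
  rw [intervalIntegral.integral_of_le hx.1.le]
  exact setIntegral_mono_set (integrableOn_of_memLp h).abs (ae_of_all _ fun x => abs_nonneg _)
    (Ioc_subset_Ioo_right hx.2).eventuallyLE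

lemma HasWeakDeriv.ae_abs_le (h : HasWeakDeriv 1 w g) (hw : IntegrableOn w (Ioo 0 1))
    (hg : MemLp g 2 vol01) :
    ∀ᵐ x ∂vol01, |w x| ≤ (∫ x in Ioo (0 : ℝ) 1, |w x|) + 2 * l2Norm g := by
  obtain ⟨c, hc⟩ := h.exists_ae_eq_primitive (integrableOn_of_memLp hg)
  have hprim : ∀ᵐ x ∂vol01, |w x - c| ≤ l2Norm g := by
    filter_upwards [hc, ae_restrict_mem measurableSet_Ioo] with x hx hx01
    rw [hx, add_sub_cancel_left]
    exact abs_primitive_le_l2Norm hg hx01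
  have hconst : |c| ≤ (∫ x in Ioo (0 : ℝ) 1, |w x|) + l2Norm g := by
    have hmono : ∫ _, |c| ∂vol01 ≤ ∫ x, (|w x| + l2Norm g) ∂vol01 := by
      refine integral_mono_ae (integrable_const _) (hw.abs.add (integrable_const _)) ?_
      filter_upwards [hprim] with x hx
      linarith [abs_sub_abs_le_abs_sub c (w x), abs_sub_comm c (w x)]
    have hwabs : Integrable (fun x => |w x|) vol01 := hw.abs
    rw [integral_add hwabs (integrable_const _)] at hmono
    rw [← vol01]
    simpa using hmono
  filter_upwards [hprim] with x hx
  linarith [abs_sub_abs_le_abs_sub (w x) c]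

lemma l2Norm_sub_eq_norm_toLp (h : MemLp w 2 vol01) (h' : MemLp w' 2 vol01) :
    l2Norm (fun x => w x - w' x) = ‖h.toLp w - h'.toLp w'‖ := by
  rw [← MemLp.toLp_sub, Lp.norm_toLp]
  exact l2Norm_eq_eLpNorm (h.sub h')

lemma exists_tendsto_l2Norm_of_cauchy {d : ℕ → ℝ → ℝ} (hd : ∀ n, MemLp (d n) 2 vol01)
    (hcauchy : ∀ ε > 0, ∃ N, ∀ i ≥ N, ∀ j ≥ N, l2Norm (fun x => d i x - d j x) < ε) :
    ∃ g, MemLp g 2 vol01 ∧ Tendsto (fun n => l2Norm (fun x => d n x - g x)) atTop (𝓝 0) := by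
  have hseq : CauchySeq fun n => (hd n).toLp (d n) := by
    simp_rw [Metric.cauchySeq_iff, dist_eq_norm, ← l2Norm_sub_eq_norm_toLp]
    exact hcauchy
  obtain ⟨G, hG⟩ := cauchySeq_tendsto_of_complete hseq
  refine ⟨G, Lp.memLp G, ?_⟩
  simp_rw [fun n => l2Norm_sub_eq_norm_toLp (hd n) (Lp.memLp G), Lp.toLp_coeFn]
  exact tendsto_iff_norm_sub_tendsto_zero.1 hG

lemma tendsto_integral_mul_of_tendsto_l2Norm {d : ℕ → ℝ → ℝ} (hd : ∀ n, MemLp (d n) 2 vol01)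
    (hg : MemLp g 2 vol01) (hw : MemLp w 2 vol01)
    (h : Tendsto (fun n => l2Norm (fun x => d n x - g x)) atTop (𝓝 0)) :
    Tendsto (fun n => ∫ x in Ioo (0 : ℝ) 1, d n x * w x) atTop
      (𝓝 (∫ x in Ioo (0 : ℝ) 1, g x * w x)) := by
  rw [tendsto_iff_norm_sub_tendsto_zero]
  refine squeeze_zero (fun _ => norm_nonneg _) (fun n => ?_)
    (by simpa using h.mul_const (l2Norm w))
  have hdw : IntegrableOn (fun x => d n x * w x) (Ioo 0 1) := (hd n).integrable_mul hw
  have hgw : IntegrableOn (fun x => g x * w x) (Ioo 0 1) := hg.integrable_mul hw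
  rw [← integral_sub hdw hgw]
  simp_rw [← sub_mul]
  exact abs_integral_mul_le_l2Norm_mul ((hd n).sub hg) hw

end LebesgueSpace

section Multiplication

variable {R Z g : ℝ → ℝ}

lemma HasWeakDeriv.contDiffOn_mul (hR : ContDiffOn ℝ 1 R (Icc 0 1)) (h : HasWeakDeriv 1 Z g)
    (hg : IntegrableOn g (Ioo 0 1)) :
    HasWeakDeriv 1 (fun x => R x * Z x)
      (fun x => derivWithin R (Icc 0 1) x * Z x + R x * g x) := by
  obtain ⟨c, hc⟩ := h.exists_ae_eq_primitive hg
  have hac := absolutelyContinuousOnInterval_primitive hg c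
  have hRac : AbsolutelyContinuousOnInterval R 0 1 :=
    ContDiffOn.absolutelyContinuousOnInterval (by rwa [uIcc_of_le zero_le_one])
  have hdiff : ∀ᵐ x ∂vol01, DifferentiableAt ℝ (fun x => c + ∫ s in (0 : ℝ)..x, g s) x := by
    refine (ae_restrict_iff' measurableSet_Ioo).2 ?_
    filter_upwards [hac.ae_differentiableAt] with x hx hx01
    exact hx (by rw [uIcc_of_le zero_le_one]; exact Ioo_subset_Icc_self hx01)
  refine (hasWeakDeriv_of_absolutelyContinuousOnInterval (hRac.fun_mul hac)).congr ?_ ?_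
  · filter_upwards [hc] with x hx
    rw [hx]
  · filter_upwards [hc, hdiff, deriv_primitive_ae_eq hg c, ae_restrict_mem measurableSet_Ioo]
      with x hx hxdiff hxderiv hx01
    have hnhds : Icc (0 : ℝ) 1 ∈ 𝓝 x := Icc_mem_nhds hx01.1 hx01.2
    have hRdiff : DifferentiableAt ℝ R x :=
      (hR.differentiableOn one_ne_zero x (Ioo_subset_Icc_self hx01)).differentiableAt hnhds
    rw [deriv_fun_mul hRdiff hxdiff, hxderiv, hx, derivWithin_of_mem_nhds hnhds]

lemma exists_l2Norm_continuousOn_mul_le (hR : ContinuousOn R (Icc 0 1)) :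
    ∃ C, 0 ≤ C ∧ ∀ Z, MemLp Z 2 vol01 →
      MemLp (fun x => R x * Z x) 2 vol01 ∧ l2Norm (fun x => R x * Z x) ≤ C * l2Norm Z := by
  obtain ⟨C, hC⟩ := isCompact_Icc.exists_bound_of_continuousOn hR
  have hC0 : 0 ≤ C := (norm_nonneg _).trans (hC 0 (left_mem_Icc.2 zero_le_one))
  have hRm : AEStronglyMeasurable R vol01 :=
    (hR.mono Ioo_subset_Icc_self).aestronglyMeasurable measurableSet_Ioo
  have hle : ∀ Z : ℝ → ℝ, ∀ᵐ x ∂vol01, ‖R x * Z x‖ ≤ C * ‖Z x‖ := fun Z => by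
    filter_upwards [ae_restrict_mem measurableSet_Ioo] with x hx
    rw [norm_mul]
    exact mul_le_mul_of_nonneg_right (hC x (Ioo_subset_Icc_self hx)) (norm_nonneg _)
  refine ⟨C, hC0, fun Z hZ => ?_⟩
  have hRZ : MemLp (fun x => R x * Z x) 2 vol01 := hZ.of_le_mul (hRm.mul hZ.1) (hle Z)
  refine ⟨hRZ, ?_⟩
  rw [l2Norm_eq_eLpNorm hZ, l2Norm_eq_eLpNorm hRZ, ← ENNReal.toReal_ofReal hC0,
    ← ENNReal.toReal_mul]
  exact ENNReal.toReal_mono (ENNReal.mul_ne_top ENNReal.ofReal_ne_top hZ.eLpNorm_ne_top)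
    (eLpNorm_le_mul_eLpNorm_of_ae_le_mul (hle Z) 2)

end Multiplication

/-- Quantitative form of membership in `H^n(0,1)`: the weak derivatives of `w` of order at most
`n` exist and are bounded by `M` in `L²(0,1)`. In contrast to `hNorm n w ≤ M`, it can be verified
one derivative at a time. -/
def SobolevBound (n : ℕ) (w : ℝ → ℝ) (M : ℝ) : Prop :=
  ∀ k ≤ n, ∃ g, HasWeakDeriv k w g ∧ MemLp g 2 vol01 ∧ l2Norm g ≤ M

lemma l2Norm_weakDeriv_le_hNorm {n k : ℕ} (hk : k ≤ n) (w : ℝ → ℝ) :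
    l2Norm (weakDeriv k w) ≤ hNorm n w :=
  Real.le_sqrt_of_sq_le (Finset.single_le_sum (f := fun k => l2Norm (weakDeriv k w) ^ 2)
    (fun _ _ => sq_nonneg _) (Finset.mem_range.2 (Nat.lt_succ_of_le hk)))

namespace MemH

variable {n k : ℕ} {w : ℝ → ℝ}

lemma hasWeakDeriv (h : MemH n w) (hk : k ≤ n) : HasWeakDeriv k w (weakDeriv k w) :=
  let ⟨_, hg, _⟩ := h k hk
  hg.weakDeriv

lemma memLp_weakDeriv (h : MemH n w) (hk : k ≤ n) : MemLp (weakDeriv k w) 2 vol01 :=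
  let ⟨_, hg, hg2⟩ := h k hk
  (memLp_congr_ae hg.weakDeriv_ae_eq).2 hg2

lemma sobolevBound (h : MemH n w) : SobolevBound n w (hNorm n w) := fun k hk =>
  ⟨weakDeriv k w, h.hasWeakDeriv hk, h.memLp_weakDeriv hk, l2Norm_weakDeriv_le_hNorm hk w⟩

end MemH

namespace SobolevBound

variable {n : ℕ} {w w' g : ℝ → ℝ} {M M' : ℝ}

lemma memH (h : SobolevBound n w M) : MemH n w := fun k hk =>
  let ⟨g, hg, hg2, _⟩ := h k hk
  ⟨g, hg, hg2⟩

lemma nonneg (h : SobolevBound n w M) : 0 ≤ M :=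
  let ⟨g, _, _, hM⟩ := h 0 n.zero_le
  (l2Norm_nonneg g).trans hM

lemma memLp_and_l2Norm_le (h : SobolevBound n w M) : MemLp w 2 vol01 ∧ l2Norm w ≤ M := by
  obtain ⟨g, hg, hg2, hgM⟩ := h 0 n.zero_le
  have hwg : w =ᵐ[vol01] g := (HasWeakDeriv.zero hg.1).ae_unique hg
  exact ⟨(memLp_congr_ae hwg).2 hg2, (l2Norm_congr hwg).trans_le hgM⟩

lemma mono (h : SobolevBound n w M) (hM : M ≤ M') : SobolevBound n w M' := fun k hk =>
  let ⟨g, hg, hg2, hgM⟩ := h k hk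
  ⟨g, hg, hg2, hgM.trans hM⟩

lemma of_succ (h : SobolevBound (n + 1) w M) : SobolevBound n w M := fun k hk =>
  h k (hk.trans n.le_succ)

lemma congr (h : SobolevBound n w M) (hw : w =ᵐ[vol01] w') : SobolevBound n w' M := fun k hk =>
  let ⟨g, hg, hg2, hgM⟩ := h k hk
  ⟨g, hg.congr hw (ae_eq_refl g), hg2, hgM⟩

lemma neg (h : SobolevBound n w M) : SobolevBound n (fun x => -w x) M := fun k hk =>
  let ⟨g, hg, hg2, hgM⟩ := h k hk
  ⟨fun x => -g x, hg.neg, hg2.neg, (l2Norm_neg g).trans_le hgM⟩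

lemma add (h : SobolevBound n w M) (h' : SobolevBound n w' M') :
    SobolevBound n (fun x => w x + w' x) (M + M') := fun k hk =>
  let ⟨_, hg, hg2, hgM⟩ := h k hk
  let ⟨_, hg', hg2', hgM'⟩ := h' k hk
  ⟨_, hg.add hg', hg2.add hg2', (l2Norm_add_le hg2 hg2').trans (add_le_add hgM hgM')⟩

protected lemma zero (hw : MemLp w 2 vol01) (hM : l2Norm w ≤ M) : SobolevBound 0 w M :=
  fun k hk => by
    obtain rfl := Nat.le_zero.1 hk
    exact ⟨w, HasWeakDeriv.zero (integrableOn_of_memLp hw).locallyIntegrableOn, hw, hM⟩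

lemma succ (hw : MemLp w 2 vol01) (hM : l2Norm w ≤ M) (hg : HasWeakDeriv 1 w g)
    (h : SobolevBound n g M) : SobolevBound (n + 1) w M
  | 0, _ => SobolevBound.zero hw hM 0 le_rfl
  | _ + 1, hk =>
    let ⟨g', hg', hbound⟩ := h _ (Nat.le_of_succ_le_succ hk)
    ⟨g', hg.succ hg', hbound⟩

lemma exists_hasWeakDeriv_one (h : SobolevBound (n + 1) w M) :
    ∃ g, HasWeakDeriv 1 w g ∧ SobolevBound n g M :=
  let ⟨g, hg, _⟩ := h 1 (Nat.le_add_left 1 n)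
  ⟨g, hg, fun k hk =>
    let ⟨g', hg', hbound⟩ := h (k + 1) (Nat.succ_le_succ hk)
    ⟨g', hg.of_succ hg', hbound⟩⟩

lemma hNorm_le (h : SobolevBound n w M) : hNorm n w ≤ (n + 1) * M := by
  have hM := h.nonneg
  have hderiv : ∀ k ∈ Finset.range (n + 1), l2Norm (weakDeriv k w) ^ 2 ≤ M ^ 2 := fun k hk => by
    obtain ⟨g, hg, -, hgM⟩ := h k (Nat.lt_succ_iff.1 (Finset.mem_range.1 hk))
    rw [l2Norm_congr hg.weakDeriv_ae_eq]
    exact pow_le_pow_left₀ (l2Norm_nonneg _) hgM 2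
  refine Real.sqrt_le_iff.2 ⟨by positivity, ?_⟩
  calc ∑ k ∈ Finset.range (n + 1), l2Norm (weakDeriv k w) ^ 2
      ≤ ∑ _ ∈ Finset.range (n + 1), M ^ 2 := Finset.sum_le_sum hderiv
    _ = (n + 1) * M ^ 2 := by simp
    _ ≤ ((n + 1) * M) ^ 2 := by
      rw [mul_pow]
      exact mul_le_mul_of_nonneg_right (by nlinarith [Nat.cast_nonneg (α := ℝ) n]) (sq_nonneg _)

lemma exists_contDiffOn_mul (n : ℕ) {R : ℝ → ℝ} (hR : ContDiffOn ℝ n R (Icc 0 1)) :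
    ∃ C, 0 ≤ C ∧ ∀ Z M, SobolevBound n Z M → SobolevBound n (fun x => R x * Z x) (C * M) := by
  induction n generalizing R with
  | zero =>
    obtain ⟨C, hC0, hC⟩ := exists_l2Norm_continuousOn_mul_le hR.continuousOn
    refine ⟨C, hC0, fun Z M h => ?_⟩
    obtain ⟨hZ, hZM⟩ := h.memLp_and_l2Norm_le
    exact SobolevBound.zero (hC Z hZ).1 ((hC Z hZ).2.trans (mul_le_mul_of_nonneg_left hZM hC0))
  | succ n ih =>
    obtain ⟨C, hC0, hC⟩ := exists_l2Norm_continuousOn_mul_le hR.continuousOn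
    obtain ⟨C', hC'0, hC'⟩ := ih (hR.derivWithin (m := n) (uniqueDiffOn_Icc zero_lt_one) le_rfl)
    obtain ⟨C'', hC''0, hC''⟩ := ih (hR.of_le (mod_cast n.le_succ))
    refine ⟨C + (C' + C''), by positivity, fun Z M h => ?_⟩
    have hM := h.nonneg
    obtain ⟨hZ, hZM⟩ := h.memLp_and_l2Norm_le
    obtain ⟨g, hZg, hg⟩ := h.exists_hasWeakDeriv_one
    refine SobolevBound.succ (hC Z hZ).1 ?_
      (hZg.contDiffOn_mul (hR.of_le (mod_cast Nat.le_add_left 1 n))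
        (integrableOn_of_memLp hg.memLp_and_l2Norm_le.1))
      (((hC' Z M h.of_succ).add (hC'' g M hg)).mono ?_)
    · calc l2Norm (fun x => R x * Z x) ≤ C * M :=
            (hC Z hZ).2.trans (mul_le_mul_of_nonneg_left hZM hC0)
        _ ≤ (C + (C' + C'')) * M := mul_le_mul_of_nonneg_right (by linarith) hM
    · rw [← add_mul]
      exact mul_le_mul_of_nonneg_right (by linarith) hM

end SobolevBound

/-! ### The kernel of the two-sided fractional integral -/

section Kernel

variable {β θ : ℝ}

/-- The one-sided power kernel `t^(β-1)` on `(0,1)`, extended by zero: differences of points of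
`(0,1)` lie in `(-1,1)`, and the truncation makes the kernel integrable on `ℝ`. -/
noncomputable def truncPow (β t : ℝ) : ℝ := (Ioo (0 : ℝ) 1).indicator (fun t => t ^ (β - 1)) t

/-- The two-sided kernel for which `I^β_θ w (x) = ∫ s in Ioo 0 1, rieszKernel β θ (x - s) * w s`. -/
noncomputable def rieszKernel (β θ t : ℝ) : ℝ :=
  θ / Real.Gamma β * truncPow β t + (1 - θ) / Real.Gamma β * truncPow β (-t)

/-- Convolution with the kernel of `I^β_θ` on the whole line; it commutes with differentiation
and is a Fourier multiplier. -/
noncomputable def rieszConv (β θ : ℝ) (w : ℝ → ℝ) (x : ℝ) : ℝ :=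
  ∫ t, rieszKernel β θ t * w (x - t)

lemma integrable_truncPow (hβ : 0 < β) : Integrable (truncPow β) := by
  have := intervalIntegral.intervalIntegrable_rpow' (a := 0) (b := 1) (r := β - 1) (by linarith)
  rw [intervalIntegrable_iff_integrableOn_Ioo_of_le zero_le_one] at this
  exact this.integrable_indicator measurableSet_Ioo

lemma integrable_rieszKernel (hβ : 0 < β) (θ : ℝ) : Integrable (rieszKernel β θ) :=
  ((integrable_truncPow hβ).const_mul _).add ((integrable_truncPow hβ).comp_neg.const_mul _)

lemma hasCompactSupport_rieszKernel (β θ : ℝ) : HasCompactSupport (rieszKernel β θ) := by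
  refine HasCompactSupport.intro (isCompact_Icc (a := (-1 : ℝ)) (b := 1)) fun t ht => ?_
  have h1 : t ∉ Ioo (0 : ℝ) 1 := fun h => ht ⟨by linarith [h.1], h.2.le⟩
  have h2 : -t ∉ Ioo (0 : ℝ) 1 := fun h => ht ⟨by linarith [h.2], by linarith [h.1]⟩
  simp [rieszKernel, truncPow, indicator_of_notMem h1, indicator_of_notMem h2]

open ContinuousLinearMap in
lemma rieszConv_eq_convolution (β θ : ℝ) (w : ℝ → ℝ) :
    rieszConv β θ w = convolution (rieszKernel β θ) w (mul ℝ ℝ) volume := rfl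

open ContinuousLinearMap in
lemma ofReal_rieszConv (β θ : ℝ) (w : ℝ → ℝ) :
    (fun x => (rieszConv β θ w x : ℂ)) =
      convolution (fun t => (rieszKernel β θ t : ℂ)) (fun t => (w t : ℂ)) (mul ℂ ℂ) volume := by
  ext x
  rw [rieszConv, convolution_def, ← integral_complex_ofReal]
  simp

lemma IsTest.contDiff_rieszConv (hβ : 0 < β) (θ : ℝ) {φ : ℝ → ℝ} (h : IsTest φ) :
    ContDiff ℝ ∞ (rieszConv β θ φ) := by
  rw [rieszConv_eq_convolution]
  exact h.2.1.contDiff_convolution_right _ (integrable_rieszKernel hβ θ).locallyIntegrable h.1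

lemma IsTest.hasDerivAt_rieszConv (hβ : 0 < β) (θ : ℝ) {φ : ℝ → ℝ} (h : IsTest φ)
    (x : ℝ) : HasDerivAt (rieszConv β θ φ) (rieszConv β θ (deriv φ) x) x := by
  rw [rieszConv_eq_convolution, rieszConv_eq_convolution]
  exact h.2.1.hasDerivAt_convolution_right _ (integrable_rieszKernel hβ θ).locallyIntegrable
    (h.1.of_le (by simp)) x

lemma IsTest.hasCompactSupport_rieszConv (β θ : ℝ) {φ : ℝ → ℝ} (h : IsTest φ) :
    HasCompactSupport (rieszConv β θ φ) := by
  rw [rieszConv_eq_convolution]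
  exact (hasCompactSupport_rieszKernel β θ).convolution _ h.2.1

end Kernel

/-! ### Fourier bound for the kernel -/

section Fourier

variable {β : ℝ}

lemma hasDerivAt_exp_mul_I_div {ν : ℝ} (hν : ν ≠ 0) (t : ℝ) :
    HasDerivAt (fun t : ℝ => Complex.exp (ν * t * Complex.I) / (ν * Complex.I))
      (Complex.exp (ν * t * Complex.I)) t := by
  have hlin : HasDerivAt (fun t : ℝ => (ν * t * Complex.I : ℂ)) (ν * Complex.I) t := by
    simpa using ((hasDerivAt_id t).ofReal_comp.const_mul (ν : ℂ)).mul_const Complex.I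
  have := hlin.cexp.div_const (ν * Complex.I)
  rwa [mul_div_cancel_right₀ _ (mul_ne_zero (by exact_mod_cast hν) Complex.I_ne_zero)] at this

lemma norm_exp_mul_I_div (ν t : ℝ) :
    ‖Complex.exp (ν * t * Complex.I) / (ν * Complex.I)‖ = |ν|⁻¹ := by
  rw [norm_div, ← Complex.ofReal_mul, Complex.norm_exp_ofReal_mul_I]
  simp

lemma norm_integral_mul_exp_le {a b : ℝ} (hab : a ≤ b) {u u' : ℝ → ℝ}
    (hu : ∀ t ∈ Icc a b, HasDerivAt u (u' t) t) (hcont : ContinuousOn u' (Icc a b))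
    (hu' : ∀ t ∈ Icc a b, u' t ≤ 0) (hb : 0 ≤ u b) {ν : ℝ} (hν : ν ≠ 0) :
    ‖∫ t in a..b, (u t : ℂ) * Complex.exp (ν * t * Complex.I)‖ ≤ 2 * u a / |ν| := by
  rw [← uIcc_of_le hab] at hu hcont
  have hint : IntervalIntegrable u' volume a b := hcont.intervalIntegrable
  have hvar : ∫ t in a..b, u' t = u b - u a :=
    intervalIntegral.integral_eq_sub_of_hasDerivAt hu hint
  have ha : u b ≤ u a := by
    have : ∫ t in a..b, u' t ≤ ∫ _ in a..b, (0 : ℝ) :=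
      intervalIntegral.integral_mono_on hab hint (by simp) hu'
    rw [hvar, intervalIntegral.integral_zero] at this
    linarith
  rw [intervalIntegral.integral_mul_deriv_eq_deriv_mul (fun t ht => (hu t ht).ofReal_comp)
    (fun t _ => hasDerivAt_exp_mul_I_div hν t) ⟨hint.1.ofReal, hint.2.ofReal⟩
    (Continuous.intervalIntegrable (by fun_prop) _ _)]
  have hrest : ‖∫ t in a..b, (u' t : ℂ) * (Complex.exp (ν * t * Complex.I) / (ν * Complex.I))‖
      ≤ (u a - u b) * |ν|⁻¹ := by
    have e : ∫ t in a..b, -u' t * |ν|⁻¹ = (u a - u b) * |ν|⁻¹ := by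
      rw [intervalIntegral.integral_mul_const, intervalIntegral.integral_neg, hvar, neg_sub]
    rw [← e]
    refine intervalIntegral.norm_integral_le_of_norm_le hab (ae_of_all _ fun t ht => ?_)
      (hint.neg.mul_const _)
    rw [norm_mul, norm_exp_mul_I_div, Complex.norm_real,
      Real.norm_of_nonpos (hu' t ⟨ht.1.le, ht.2⟩)]
  have hbdry (t : ℝ) (ht : 0 ≤ u t) :
      ‖(u t : ℂ) * (Complex.exp (ν * t * Complex.I) / (ν * Complex.I))‖ = u t * |ν|⁻¹ := by
    rw [norm_mul, norm_exp_mul_I_div, Complex.norm_real, Real.norm_of_nonneg ht]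
  calc _ ≤ _ := (norm_sub_le _ _).trans (add_le_add (norm_sub_le _ _) hrest)
    _ = 2 * u a / |ν| := by rw [hbdry b hb, hbdry a (hb.trans ha)]; ring

lemma norm_integral_rpow_mul_exp_zero_le (hβ : 0 < β) {δ : ℝ} (hδ : 0 ≤ δ) (ν : ℝ) :
    ‖∫ t in (0 : ℝ)..δ, ((t ^ (β - 1) : ℝ) : ℂ) * Complex.exp (ν * t * Complex.I)‖ ≤ δ ^ β / β := by
  have e : ∫ t in (0 : ℝ)..δ, t ^ (β - 1) = δ ^ β / β := by
    rw [integral_rpow (Or.inl (by linarith))]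
    simp [Real.zero_rpow hβ.ne']
  rw [← e]
  refine intervalIntegral.norm_integral_le_of_norm_le hδ (ae_of_all _ fun t ht => ?_)
    (intervalIntegral.intervalIntegrable_rpow' (by linarith))
  rw [norm_mul, ← Complex.ofReal_mul, Complex.norm_exp_ofReal_mul_I, mul_one, Complex.norm_real,
    Real.norm_of_nonneg (Real.rpow_nonneg ht.1.le _)]

lemma norm_integral_rpow_mul_exp_tail_le (hβ1 : β ≤ 1) {δ : ℝ} (hδ : 0 < δ) (hδ1 : δ ≤ 1)
    {ν : ℝ} (hν : ν ≠ 0) :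
    ‖∫ t in δ..1, ((t ^ (β - 1) : ℝ) : ℂ) * Complex.exp (ν * t * Complex.I)‖
      ≤ 2 * δ ^ (β - 1) / |ν| := by
  have hpos : ∀ t ∈ Icc δ 1, 0 < t := fun t ht => hδ.trans_le ht.1
  refine norm_integral_mul_exp_le hδ1 (u' := fun t => (β - 1) * t ^ (β - 1 - 1))
    (fun t ht => Real.hasDerivAt_rpow_const (Or.inl (hpos t ht).ne'))
    (fun t ht => ((Real.continuousAt_rpow_const _ _ (Or.inl (hpos t ht).ne')).const_mul
      _).continuousWithinAt)
    (fun t ht => mul_nonpos_of_nonpos_of_nonneg (by linarith) (Real.rpow_nonneg (hpos t ht).le _))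
    (by simp) hν

lemma norm_integral_rpow_mul_exp_le (hβ : 0 < β) (hβ1 : β ≤ 1) {ν : ℝ} (hν : ν ≠ 0) :
    ‖∫ t in (0 : ℝ)..1, ((t ^ (β - 1) : ℝ) : ℂ) * Complex.exp (ν * t * Complex.I)‖
      ≤ (1 / β + 2) * |ν| ^ (-β) := by
  have hν0 : 0 < |ν| := abs_pos.2 hν
  rcases le_total |ν| 1 with h | h
  · have h1 : 1 ≤ |ν| ^ (-β) := Real.one_le_rpow_of_pos_of_le_one_of_nonpos hν0 h (by linarith)
    have hβi : 0 < 1 / β := by positivity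
    refine (norm_integral_rpow_mul_exp_zero_le hβ zero_le_one ν).trans ?_
    rw [Real.one_rpow]
    nlinarith
  · have hi (a b : ℝ) : IntervalIntegrable
        (fun t : ℝ => ((t ^ (β - 1) : ℝ) : ℂ) * Complex.exp (ν * t * Complex.I)) volume a b := by
      have := intervalIntegral.intervalIntegrable_rpow' (a := a) (b := b) (r := β - 1)
        (by linarith)
      exact .mul_continuousOn ⟨this.1.ofReal, this.2.ofReal⟩ (by fun_prop)
    have hδ : |ν|⁻¹ ^ (β - 1) / |ν| = |ν| ^ (-β) := by
      rw [Real.inv_rpow hν0.le, ← Real.rpow_neg hν0.le, ← Real.rpow_sub_one hν0.ne']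
      ring_nf
    rw [← intervalIntegral.integral_add_adjacent_intervals (hi 0 |ν|⁻¹) (hi _ 1)]
    calc _ ≤ |ν|⁻¹ ^ β / β + 2 * |ν|⁻¹ ^ (β - 1) / |ν| :=
          norm_add_le_of_le (norm_integral_rpow_mul_exp_zero_le hβ (inv_nonneg.2 hν0.le) ν)
            (norm_integral_rpow_mul_exp_tail_le hβ1 (inv_pos.2 hν0) (inv_le_one_of_one_le₀ h) hν)
      _ = (1 / β + 2) * |ν| ^ (-β) := by
        rw [mul_div_assoc, hδ, Real.inv_rpow hν0.le, ← Real.rpow_neg hν0.le]; ring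

lemma norm_fourier_truncPow_le (hβ : 0 < β) (hβ1 : β ≤ 1) {ξ : ℝ} (hξ : ξ ≠ 0) :
    ‖𝓕 (fun t => (truncPow β t : ℂ)) ξ‖ ≤ (1 / β + 2) * (2 * Real.pi * |ξ|) ^ (-β) := by
  have h := norm_integral_rpow_mul_exp_le hβ hβ1 (ν := -(2 * Real.pi * ξ))
    (by simpa [Real.pi_ne_zero] using hξ)
  rw [abs_neg, abs_mul, abs_of_pos (by positivity : 0 < 2 * Real.pi)] at h
  convert h using 2
  rw [Real.fourier_real_eq_integral_exp_smul, intervalIntegral.integral_of_le zero_le_one,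
    integral_Ioc_eq_integral_Ioo, ← integral_indicator measurableSet_Ioo]
  congr 1
  ext t
  by_cases ht : t ∈ Ioo (0 : ℝ) 1
  · rw [indicator_of_mem ht, truncPow, indicator_of_mem ht, smul_eq_mul, mul_comm]
    congr 2
    push_cast
    ring
  · rw [indicator_of_notMem ht, truncPow, indicator_of_notMem ht]
    simp

lemma fourier_rieszKernel (hβ : 0 < β) (θ ξ : ℝ) :
    𝓕 (fun t => (rieszKernel β θ t : ℂ)) ξ =
      ((θ / Real.Gamma β : ℝ) : ℂ) * 𝓕 (fun t => (truncPow β t : ℂ)) ξ +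
      (((1 - θ) / Real.Gamma β : ℝ) : ℂ) * 𝓕 (fun t => (truncPow β t : ℂ)) (-ξ) := by
  have hT := (integrable_truncPow hβ).ofReal (𝕜 := ℂ)
  have hneg : 𝓕 (fun t => (truncPow β (-t) : ℂ)) ξ = 𝓕 (fun t => (truncPow β t : ℂ)) (-ξ) := by
    rw [Real.fourier_real_eq_integral_exp_smul, Real.fourier_real_eq_integral_exp_smul,
      ← integral_neg_eq_self]
    simp
  rw [← hneg, ← smul_eq_mul, ← smul_eq_mul]
  simp_rw [Real.fourier_eq]
  rw [← integral_smul, ← integral_smul, ← integral_add]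
  · congr 1
    ext t
    simp only [rieszKernel, Circle.smul_def, smul_eq_mul]
    push_cast
    ring
  · exact ((Real.fourierIntegral_convergent_iff ξ).2 hT).smul ((θ / Real.Gamma β : ℝ) : ℂ)
  · exact ((Real.fourierIntegral_convergent_iff ξ).2 hT.comp_neg).smul
      (((1 - θ) / Real.Gamma β : ℝ) : ℂ)

lemma exists_norm_fourier_rieszKernel_le (hβ : 0 < β) (hβ1 : β ≤ 1) (θ : ℝ) :
    ∃ C, 0 ≤ C ∧ ∀ ξ : ℝ, ξ ≠ 0 →
      ‖𝓕 (fun t => (rieszKernel β θ t : ℂ)) ξ‖ ≤ C * (2 * Real.pi * |ξ|) ^ (-β) := by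
  refine ⟨(|θ / Real.Gamma β| + |(1 - θ) / Real.Gamma β|) * (1 / β + 2), by positivity,
    fun ξ hξ => ?_⟩
  have hpos := norm_fourier_truncPow_le hβ hβ1 hξ
  have hneg := norm_fourier_truncPow_le hβ hβ1 (neg_ne_zero.2 hξ)
  rw [abs_neg] at hneg
  rw [fourier_rieszKernel hβ, mul_assoc, add_mul]
  refine norm_add_le_of_le ?_ ?_ <;> rw [norm_mul, Complex.norm_real, Real.norm_eq_abs] <;> gcongr

end Fourier

/-! ### The fractional integral in the fractional Sobolev norm -/

section FourierNorm

variable {β : ℝ} {w φ : ℝ → ℝ}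

/-- A smooth compactly supported real function as a complex Schwartz function, to which
Plancherel's theorem applies. -/
noncomputable def schwartzOfReal (w : ℝ → ℝ) (h1 : ContDiff ℝ ∞ w) (h2 : HasCompactSupport w) :
    SchwartzMap ℝ ℂ :=
  HasCompactSupport.toSchwartzMap (f := fun x => (w x : ℂ)) (h2.comp_left (g := Complex.ofReal) rfl)
    (Complex.ofRealCLM.contDiff.comp h1)

lemma integral_sq_eq_integral_fourier (h1 : ContDiff ℝ ∞ w) (h2 : HasCompactSupport w) :
    ∫ x, w x ^ 2 = ∫ ξ, ‖𝓕 (fun x => (w x : ℂ)) ξ‖ ^ 2 := by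
  have plancherel := SchwartzMap.integral_norm_sq_fourier (schwartzOfReal w h1 h2)
  have e (x : ℝ) : ‖schwartzOfReal w h1 h2 x‖ ^ 2 = w x ^ 2 := by
    change ‖(w x : ℂ)‖ ^ 2 = _
    simp
  rw [SchwartzMap.fourier_coe] at plancherel
  simp_rw [e] at plancherel
  exact plancherel.symm

lemma integrable_norm_fourier_sq (h1 : ContDiff ℝ ∞ w) (h2 : HasCompactSupport w) :
    Integrable (fun ξ => ‖𝓕 (fun x => (w x : ℂ)) ξ‖ ^ 2) :=
  (SchwartzMap.memLp (𝓕 (schwartzOfReal w h1 h2)) 2 volume).integrable_norm_pow two_ne_zero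

lemma IsTest.norm_fourier_deriv (h : IsTest φ) (ξ : ℝ) :
    ‖𝓕 (fun x => ((deriv φ x : ℝ) : ℂ)) ξ‖ = 2 * Real.pi * |ξ| * ‖𝓕 (fun x => (φ x : ℂ)) ξ‖ := by
  have hd (x : ℝ) := (h.differentiable x).hasDerivAt.ofReal_comp
  have e : deriv (fun x => (φ x : ℂ)) = fun x => ((deriv φ x : ℝ) : ℂ) :=
    funext fun x => (hd x).deriv
  rw [← e, Real.fourier_deriv h.integrable.ofReal (fun x => (hd x).differentiableAt)
    (e ▸ h.deriv.integrable.ofReal)]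
  simp [abs_of_pos Real.pi_pos]

lemma rpow_mul_sq_le {p μ : ℝ} (hp : 0 ≤ p) (hμ : 0 ≤ μ) (hμ1 : μ ≤ 1) (y : ℝ) :
    (p ^ μ * y) ^ 2 ≤ 2 * y ^ 2 + 2 * (p * y) ^ 2 := by
  have hle : p ^ μ ≤ 1 + p := by
    rcases le_total p 1 with h | h
    · linarith [Real.rpow_le_one hp h hμ]
    · have := Real.rpow_le_rpow_of_exponent_le h hμ1
      rw [Real.rpow_one] at this
      linarith
  calc (p ^ μ * y) ^ 2 = (p ^ μ) ^ 2 * y ^ 2 := mul_pow _ _ _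
    _ ≤ (1 + p) ^ 2 * y ^ 2 := by gcongr
    _ ≤ 2 * y ^ 2 + 2 * (p * y) ^ 2 := by nlinarith [mul_nonneg (sq_nonneg (1 - p)) (sq_nonneg y)]

lemma IsTest.integrable_rpow_mul_fourier_sq (h : IsTest φ) {μ : ℝ} (hμ : 0 ≤ μ) (hμ1 : μ ≤ 1) :
    Integrable fun ξ : ℝ => ((2 * Real.pi * |ξ|) ^ μ * ‖𝓕 (fun x => (φ x : ℂ)) ξ‖) ^ 2 := by
  have hφ' := h.deriv
  refine (((integrable_norm_fourier_sq h.1 h.2.1).const_mul 2).add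
    ((integrable_norm_fourier_sq hφ'.1 hφ'.2.1).const_mul 2)).mono' ?_ (ae_of_all _ fun ξ => ?_)
  · have hcont : Continuous (𝓕 (fun x => (φ x : ℂ))) :=
      (𝓕 (schwartzOfReal φ h.1 h.2.1)).continuous
    have hpow : Continuous (fun ξ : ℝ => (2 * Real.pi * |ξ|) ^ μ) :=
      (by fun_prop : Continuous fun ξ : ℝ => 2 * Real.pi * |ξ|).rpow_const fun _ => Or.inr hμ
    exact ((hpow.mul hcont.norm).pow 2).aestronglyMeasurable
  · rw [Real.norm_of_nonneg (sq_nonneg _), Pi.add_apply, h.norm_fourier_deriv]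
    exact rpow_mul_sq_le (by positivity) hμ hμ1 _

lemma IsTest.norm_fourier_rieszConv_deriv_le {C θ ξ : ℝ} (hβ : 0 < β) (h : IsTest φ) (hξ : ξ ≠ 0)
    (hC : ‖𝓕 (fun t => (rieszKernel β θ t : ℂ)) ξ‖ ≤ C * (2 * Real.pi * |ξ|) ^ (-β)) :
    ‖𝓕 (fun x => (rieszConv β θ (deriv φ) x : ℂ)) ξ‖ ≤
      C * ((2 * Real.pi * |ξ|) ^ (1 - β) * ‖𝓕 (fun x => (φ x : ℂ)) ξ‖) := by
  have hp : 0 < 2 * Real.pi * |ξ| := by positivity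
  have hmul := Real.fourier_mul_convolution_eq (f₁ := fun t => (rieszKernel β θ t : ℂ))
    (f₂ := fun t => ((deriv φ t : ℝ) : ℂ)) (integrable_rieszKernel hβ θ).ofReal
    h.deriv.integrable.ofReal ξ
  rw [ofReal_rieszConv, hmul, norm_mul, h.norm_fourier_deriv]
  calc _ ≤ (C * (2 * Real.pi * |ξ|) ^ (-β)) *
        (2 * Real.pi * |ξ| * ‖𝓕 (fun x => (φ x : ℂ)) ξ‖) :=
        mul_le_mul_of_nonneg_right hC (by positivity)
    _ = _ := by rw [show 1 - β = -β + 1 by ring, Real.rpow_add hp, Real.rpow_one]; ring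

lemma exists_l2Norm_rieszConv_deriv_le (hβ : 0 < β) (hβ1 : β ≤ 1) (θ : ℝ) :
    ∃ C, 0 ≤ C ∧ ∀ φ, IsTest φ → l2Norm (rieszConv β θ (deriv φ)) ≤ C * fracNorm (1 - β) φ := by
  obtain ⟨C, hC0, hC⟩ := exists_norm_fourier_rieszKernel_le hβ hβ1 θ
  refine ⟨C, hC0, fun φ h => ?_⟩
  have hs := h.deriv.contDiff_rieszConv hβ θ
  have hc := h.deriv.hasCompactSupport_rieszConv β θ
  have hline : ∫ x, rieszConv β θ (deriv φ) x ^ 2 ≤ C ^ 2 *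
      ∫ ξ : ℝ, ((2 * Real.pi * |ξ|) ^ (1 - β) * ‖𝓕 (fun x => (φ x : ℂ)) ξ‖) ^ 2 := by
    rw [integral_sq_eq_integral_fourier hs hc, ← integral_const_mul]
    refine integral_mono_ae (integrable_norm_fourier_sq hs hc)
      ((h.integrable_rpow_mul_fourier_sq (by linarith) (by linarith)).const_mul _) ?_
    filter_upwards [compl_mem_ae_iff.2 (measure_singleton (0 : ℝ))] with ξ hξ
    rw [← mul_pow]
    exact pow_le_pow_left₀ (norm_nonneg _) (h.norm_fourier_rieszConv_deriv_le hβ hξ (hC ξ hξ)) 2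
  have hrestrict : ∫ x in Ioo (0 : ℝ) 1, rieszConv β θ (deriv φ) x ^ 2 ≤
      ∫ x, rieszConv β θ (deriv φ) x ^ 2 :=
    setIntegral_le_integral (hs.continuous.memLp_of_hasCompactSupport (p := 2) hc).integrable_sq
      (ae_of_all _ fun x => sq_nonneg _)
  rw [l2Norm, fracNorm, ← Real.sqrt_sq hC0, ← Real.sqrt_mul (sq_nonneg _)]
  refine Real.sqrt_le_sqrt ((hrestrict.trans hline).trans ?_)
  gcongr
  exact le_add_of_nonneg_left (integral_nonneg fun x => sq_nonneg _)

end FourierNorm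

/-! ### A weight with constant adjoint fractional integral -/

section Beta

variable {a b p q r β : ℝ}

/-- Euler's beta integral, with the exponents themselves as arguments: it is `B(p + 1, q + 1)`. -/
noncomputable def betaInt (p q : ℝ) : ℝ := ∫ t in Ioo (0 : ℝ) 1, t ^ p * (1 - t) ^ q

lemma integrableOn_beta (hp : -1 < p) (hq : -1 < q) :
    IntegrableOn (fun t : ℝ => t ^ p * (1 - t) ^ q) (Ioo 0 1) := by
  have h := Complex.betaIntegral_convergent (u := (p + 1 : ℝ)) (v := (q + 1 : ℝ))
    (by rw [Complex.ofReal_re]; linarith) (by rw [Complex.ofReal_re]; linarith)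
  rw [intervalIntegrable_iff_integrableOn_Ioo_of_le zero_le_one] at h
  refine IntegrableOn.congr_fun (Integrable.norm h) (fun t ht => ?_) measurableSet_Ioo
  have h1 : 0 < 1 - t := by linarith [ht.2]
  have e1 : ((p + 1 : ℝ) : ℂ) - 1 = (p : ℂ) := by push_cast; ring
  have e2 : ((q + 1 : ℝ) : ℂ) - 1 = (q : ℂ) := by push_cast; ring
  have e3 : (1 : ℂ) - t = ((1 - t : ℝ) : ℂ) := by push_cast; ring
  rw [e1, e2, e3, norm_mul, Complex.norm_cpow_eq_rpow_re_of_pos ht.1,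
    Complex.norm_cpow_eq_rpow_re_of_pos h1]
  simp

lemma betaInt_nonneg (p q : ℝ) : 0 ≤ betaInt p q :=
  setIntegral_nonneg measurableSet_Ioo fun t ht =>
    mul_nonneg (Real.rpow_nonneg ht.1.le _) (Real.rpow_nonneg (by linarith [ht.2]) _)

lemma continuousOn_betaInt (hr : -1 < r) (hq : -1 < q) :
    ContinuousOn (fun p => betaInt p q) (Ici r) := by
  refine continuousOn_of_dominated (bound := fun t => t ^ r * (1 - t) ^ q)
    (fun p hp => (integrableOn_beta (lt_of_lt_of_le hr hp) hq).1) (fun p hp => ?_)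
    (integrableOn_beta hr hq) ?_
  · filter_upwards [ae_restrict_mem measurableSet_Ioo] with t ht
    have h1 : 0 ≤ (1 - t) ^ q := Real.rpow_nonneg (by linarith [ht.2]) _
    rw [norm_mul, Real.norm_of_nonneg h1, Real.norm_of_nonneg (Real.rpow_nonneg ht.1.le _)]
    exact mul_le_mul_of_nonneg_right
      (Real.rpow_le_rpow_of_exponent_ge ht.1 ht.2.le hp) h1
  · filter_upwards [ae_restrict_mem measurableSet_Ioo] with t ht
    exact ((Real.continuous_const_rpow ht.1.ne').mul continuous_const).continuousOn

lemma exists_exponents {θ : ℝ} (hβ : 0 < β) (hβ1 : β < 1) (hθ : 0 ≤ θ) (hθ1 : θ ≤ 1) :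
    ∃ a b, a ≤ 0 ∧ b ≤ 0 ∧ a + b = -β ∧
      θ * a * betaInt b (β - 1) = (1 - θ) * b * betaInt a (β - 1) := by
  let F : ℝ → ℝ := fun b => θ * (-β - b) * betaInt b (β - 1) -
    (1 - θ) * b * betaInt (-β - b) (β - 1)
  have hB := continuousOn_betaInt (r := -β) (q := β - 1) (by linarith) (by linarith)
  have hB₁ : ContinuousOn (fun b => betaInt b (β - 1)) (Icc (-β) 0) := hB.mono Icc_subset_Ici_self
  have hB₂ : ContinuousOn (fun b => betaInt (-β - b) (β - 1)) (Icc (-β) 0) :=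
    hB.comp (by fun_prop) fun b hb => by simp only [mem_Ici]; linarith [hb.2]
  have hF : ContinuousOn F (Icc (-β) 0) := by fun_prop
  have h0 := betaInt_nonneg 0 (β - 1)
  have hright : F 0 ≤ 0 := by
    have : 0 ≤ θ * β * betaInt 0 (β - 1) := by positivity
    simp only [F]
    linarith
  have hleft : 0 ≤ F (-β) := by
    have : 0 ≤ (1 - θ) * β * betaInt 0 (β - 1) :=
      mul_nonneg (mul_nonneg (by linarith) hβ.le) h0
    simp only [F, sub_self, mul_zero, zero_mul]
    linarith
  obtain ⟨b, hb, hFb⟩ := intermediate_value_Icc' (by linarith : -β ≤ 0) hF ⟨hright, hleft⟩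
  exact ⟨-β - b, b, by linarith [hb.1], hb.2, by ring, sub_eq_zero.1 hFb⟩

end Beta

section Mobius

variable {a b c t β : ℝ}

/-- The Möbius transformation fixing `0` and `1` and sending `c` to `∞`. -/
noncomputable def mobius (c t : ℝ) : ℝ := t * (c - 1) / (c - t)

lemma one_sub_mobius (h : t < c) : 1 - mobius c t = c * (1 - t) / (c - t) := by
  have : 0 < c - t := by linarith
  unfold mobius
  field_simp
  ring

lemma hasDerivAt_mobius (h : t < c) : HasDerivAt (mobius c) ((c - 1) * c / (c - t) ^ 2) t := by
  refine (((hasDerivAt_id t).mul_const (c - 1)).div ((hasDerivAt_id t).const_sub c)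
    (by simp only [id]; linarith)).congr_deriv ?_
  simp only [id]
  ring

lemma bijOn_mobius (hc : 1 < c) : BijOn (mobius c) (Ioo 0 1) (Ioo 0 1) := by
  have hc1 : 0 < c - 1 := by linarith
  refine ⟨fun t ht => ?_, fun t ht s hs h => ?_, fun y hy => ?_⟩
  · have hct : 0 < c - t := by linarith [ht.2]
    exact ⟨div_pos (mul_pos ht.1 hc1) hct, (div_lt_one hct).2 (by nlinarith [ht.2])⟩
  · have hct : c - t ≠ 0 := by linarith [ht.2]
    have hcs : c - s ≠ 0 := by linarith [hs.2]
    rw [mobius, mobius, div_eq_div_iff hct hcs] at h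
    have : (t - s) * (c * (c - 1)) = 0 := by linear_combination h
    have := (mul_eq_zero.1 this).resolve_right (by positivity)
    linarith
  · have hcy : 0 < c - 1 + y := by linarith [hy.1]
    have hc0 : 0 < c := by linarith
    refine ⟨c * y / (c - 1 + y), ⟨div_pos (mul_pos hc0 hy.1) hcy,
      (div_lt_one hcy).2 (by nlinarith [hy.2])⟩, ?_⟩
    have : c - c * y / (c - 1 + y) = c * (c - 1) / (c - 1 + y) := by
      field_simp
      ring
    rw [mobius, this]
    field_simp

lemma deriv_mobius_mul_beta (hab : a + b = -β) (hc : 1 < c) (ht : t ∈ Ioo (0 : ℝ) 1) :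
    (c - 1) * c / (c - t) ^ 2 * (mobius c t ^ a * (1 - mobius c t) ^ (β - 1)) *
        ((c - 1) ^ (-a - 1) * c ^ (-β)) =
      t ^ a * (1 - t) ^ (β - 1) * (c - t) ^ (b - 1) := by
  have hc1 : 0 < c - 1 := by linarith
  have hc0 : 0 < c := by linarith
  have h1t : 0 < 1 - t := by linarith [ht.2]
  have hct : 0 < c - t := by linarith [ht.2]
  rw [one_sub_mobius (by linarith), mobius, Real.div_rpow (by nlinarith [ht.1]) hct.le,
    Real.div_rpow (by positivity) hct.le, Real.mul_rpow ht.1.le hc1.le,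
    Real.mul_rpow hc0.le h1t.le]
  have p1 : (c - 1) ^ (-a - 1) = ((c - 1) ^ a)⁻¹ * (c - 1)⁻¹ := by
    rw [Real.rpow_sub hc1, Real.rpow_neg hc1.le, Real.rpow_one, div_eq_mul_inv]
  have p2 : c ^ (-β) = (c ^ (β - 1))⁻¹ * c⁻¹ := by
    rw [← Real.rpow_neg hc0.le, ← Real.rpow_neg_one c, ← Real.rpow_add hc0]
    ring_nf
  have p3 : (c - t) ^ (b - 1) = ((c - t) ^ a)⁻¹ * ((c - t) ^ (β - 1))⁻¹ * ((c - t) ^ 2)⁻¹ := by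
    rw [← Real.rpow_neg hct.le, ← Real.rpow_neg hct.le, ← Real.rpow_natCast,
      ← Real.rpow_neg hct.le, ← Real.rpow_add hct, ← Real.rpow_add hct]
    congr 1
    push_cast
    linarith
  have q1 : (c - 1) ^ a ≠ 0 := (Real.rpow_pos_of_pos hc1 _).ne'
  have q2 : c ^ (β - 1) ≠ 0 := (Real.rpow_pos_of_pos hc0 _).ne'
  rw [p1, p2, p3]
  field_simp

lemma setIntegral_mobius_beta (hab : a + b = -β) (hc : 1 < c) :
    ∫ t in Ioo (0 : ℝ) 1, t ^ a * (1 - t) ^ (β - 1) * (c - t) ^ (b - 1) =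
      betaInt a (β - 1) * ((c - 1) ^ (-a - 1) * c ^ (-β)) := by
  have hbij := bijOn_mobius hc
  have hsubst := integral_image_eq_integral_abs_deriv_smul measurableSet_Ioo
    (fun t ht => (hasDerivAt_mobius (c := c) (ht.2.trans hc)).hasDerivWithinAt) hbij.injOn
    (fun y => y ^ a * (1 - y) ^ (β - 1))
  rw [hbij.image_eq] at hsubst
  rw [betaInt, hsubst, ← integral_mul_const]
  refine setIntegral_congr_fun measurableSet_Ioo fun t ht => ?_
  have hpos : 0 ≤ (c - 1) * c / (c - t) ^ 2 :=
    div_nonneg (mul_nonneg (by linarith) (by linarith)) (sq_nonneg _)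
  simp only [smul_eq_mul]
  rw [abs_of_nonneg hpos, deriv_mobius_mul_beta hab hc ht]

end Mobius

section WeightIntegral

variable {a b c s β : ℝ}

lemma continuousOn_sub_rpow (hc : 1 < c) (r : ℝ) :
    ContinuousOn (fun t : ℝ => (c - t) ^ r) (Icc 0 1) :=
  ContinuousOn.rpow_const (by fun_prop) fun t ht => Or.inl (by linarith [ht.2])

lemma integrableOn_mul_sub_rpow {g : ℝ → ℝ} (hg : IntegrableOn g (Ioo 0 1)) (hc : 1 < c) (r : ℝ) :
    IntegrableOn (fun t => g t * (c - t) ^ r) (Ioo 0 1) := by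
  have hr := continuousOn_sub_rpow hc r
  obtain ⟨C, hC⟩ := isCompact_Icc.exists_bound_of_continuousOn hr
  refine Integrable.mul_bdd (c := C) hg
    ((hr.mono Ioo_subset_Icc_self).aestronglyMeasurable measurableSet_Ioo) ?_
  filter_upwards [ae_restrict_mem measurableSet_Ioo] with x hx
  exact hC x (Ioo_subset_Icc_self hx)

lemma hasDerivAt_setIntegral_mul_sub_rpow {g : ℝ → ℝ} (hg : IntegrableOn g (Ioo 0 1))
    (hb : b ≤ 1) (hc : 1 < c) :
    HasDerivAt (fun c => ∫ t in Ioo (0 : ℝ) 1, g t * (c - t) ^ b)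
      (b * ∫ t in Ioo (0 : ℝ) 1, g t * (c - t) ^ (b - 1)) c := by
  have hgap {t c' : ℝ} (ht : t ∈ Ioo (0 : ℝ) 1) (hc' : c' ∈ Ioi ((1 + c) / 2)) :
      (c - 1) / 2 < c' - t := by
    have := mem_Ioi.1 hc'
    linarith [ht.2]
  have hderiv := hasDerivAt_integral_of_dominated_loc_of_deriv_le (𝕜 := ℝ)
    (μ := volume.restrict (Ioo (0 : ℝ) 1)) (x₀ := c) (s := Ioi ((1 + c) / 2))
    (F := fun c t => g t * (c - t) ^ b) (F' := fun c t => b * (g t * (c - t) ^ (b - 1)))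
    (bound := fun t => |b| * (‖g t‖ * ((c - 1) / 2) ^ (b - 1)))
    (Ioi_mem_nhds (by linarith)) ?_ (integrableOn_mul_sub_rpow hg hc b)
    ((integrableOn_mul_sub_rpow hg hc (b - 1)).const_mul b).1 ?_
    ((hg.norm.mul_const _).const_mul _) ?_
  · exact hderiv.2.congr_deriv (integral_const_mul _ _)
  · filter_upwards [Ioi_mem_nhds hc] with c' hc'
    exact (integrableOn_mul_sub_rpow hg hc' b).1
  · filter_upwards [ae_restrict_mem measurableSet_Ioo] with t ht c' hc'
    have hgap' := hgap ht hc'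
    have h0 : 0 < (c - 1) / 2 := by linarith
    rw [norm_mul, norm_mul, Real.norm_of_nonneg (Real.rpow_nonneg (h0.trans hgap').le _),
      Real.norm_eq_abs b]
    exact mul_le_mul_of_nonneg_left (mul_le_mul_of_nonneg_left
      (Real.rpow_le_rpow_of_nonpos h0 hgap'.le (by linarith)) (norm_nonneg _)) (abs_nonneg _)
  · filter_upwards [ae_restrict_mem measurableSet_Ioo] with t ht c' hc'
    have hne : c' - t ≠ 0 := by linarith [hgap ht hc']
    refine ((((hasDerivAt_id c').sub_const t).rpow_const (p := b) (Or.inl hne)).const_mul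
      (g t)).congr_deriv ?_
    simp only [id]
    ring

/-- The left fractional integral, up to the factor `1/Γ(β)`, of the weight `x^a (1-x)^b`; the right
one is obtained from it by reflection. -/
noncomputable def weightInt (β a b s : ℝ) : ℝ :=
  ∫ x in Ioo (0 : ℝ) 1, truncPow β (s - x) * (x ^ a * (1 - x) ^ b)

lemma indicator_weight_scaled (hab : a + b = -β) (hs : s ∈ Ioo (0 : ℝ) 1) (t : ℝ) :
    (Ioo (0 : ℝ) 1).indicator (fun x => truncPow β (s - x) * (x ^ a * (1 - x) ^ b)) (s * t) =
    s⁻¹ * (Ioo (0 : ℝ) 1).indicator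
      (fun t => t ^ a * (1 - t) ^ (β - 1) * (s⁻¹ - t) ^ b) t := by
  have hs0 := hs.1
  by_cases ht : t ∈ Ioo (0 : ℝ) 1
  · have h1t : 0 < 1 - t := by linarith [ht.2]
    have hst : s * t < s := by nlinarith [ht.2]
    have hst0 : 0 < s * t := mul_pos hs0 ht.1
    rw [indicator_of_mem ht, indicator_of_mem (show s * t ∈ Ioo (0 : ℝ) 1 from
      ⟨hst0, by linarith [hs.2]⟩), truncPow, indicator_of_mem
      (show s - s * t ∈ Ioo (0 : ℝ) 1 from ⟨by linarith, by linarith [hs.2]⟩)]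
    have e1 : s - s * t = s * (1 - t) := by ring
    have e2 : 1 - s * t = s * (s⁻¹ - t) := by field_simp
    have h2 : 0 < s⁻¹ - t := by linarith [(one_lt_inv₀ hs0).2 hs.2, ht.2]
    rw [e1, e2, Real.mul_rpow hs0.le h1t.le, Real.mul_rpow hs0.le ht.1.le,
      Real.mul_rpow hs0.le h2.le]
    have p : s ^ (β - 1) * s ^ a * s ^ b = s⁻¹ := by
      rw [← Real.rpow_add hs0, ← Real.rpow_add hs0, ← Real.rpow_neg_one]
      congr 1
      linarith
    rw [← p]
    ring
  · rw [indicator_of_notMem ht, mul_zero]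
    by_cases h : s * t ∈ Ioo (0 : ℝ) 1
    · rw [indicator_of_mem h, truncPow, indicator_of_notMem, zero_mul]
      intro h'
      exact ht ⟨pos_of_mul_pos_right h.1 hs0.le, by nlinarith [h'.1]⟩
    · rw [indicator_of_notMem h]

lemma integrableOn_truncPow_mul_weight (hβ : 0 < β) (ha : -1 < a) (hab : a + b = -β)
    (hs : s ∈ Ioo (0 : ℝ) 1) :
    IntegrableOn (fun x => truncPow β (s - x) * (x ^ a * (1 - x) ^ b)) (Ioo 0 1) := by
  rw [← integrable_indicator_iff measurableSet_Ioo, ← integrable_comp_mul_left_iff _ hs.1.ne']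
  simp_rw [indicator_weight_scaled hab hs]
  exact ((integrableOn_mul_sub_rpow (integrableOn_beta ha (by linarith))
    ((one_lt_inv₀ hs.1).2 hs.2) b).integrable_indicator measurableSet_Ioo).const_mul _

lemma weightInt_eq (hab : a + b = -β) (hs : s ∈ Ioo (0 : ℝ) 1) :
    weightInt β a b s = ∫ t in Ioo (0 : ℝ) 1, t ^ a * (1 - t) ^ (β - 1) * (s⁻¹ - t) ^ b := by
  have h := Measure.integral_comp_mul_left ((Ioo (0 : ℝ) 1).indicator
    (fun x => truncPow β (s - x) * (x ^ a * (1 - x) ^ b))) s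
  simp_rw [indicator_weight_scaled hab hs] at h
  rw [integral_const_mul, integral_indicator measurableSet_Ioo,
    integral_indicator measurableSet_Ioo, abs_of_pos (inv_pos.2 hs.1), smul_eq_mul] at h
  exact (mul_left_cancel₀ (inv_pos.2 hs.1).ne' h).symm

lemma hasDerivAt_weightInt (hβ : 0 < β) (ha : -1 < a) (hab : a + b = -β)
    (hs : s ∈ Ioo (0 : ℝ) 1) :
    HasDerivAt (weightInt β a b)
      (-b * betaInt a (β - 1) * (s ^ (-b - 1) * (1 - s) ^ (-a - 1))) s := by
  have hs0 := hs.1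
  have h1s : 0 < 1 - s := by linarith [hs.2]
  have hc := (one_lt_inv₀ hs0).2 hs.2
  have hcomp := (hasDerivAt_setIntegral_mul_sub_rpow
    (integrableOn_beta ha (by linarith : -1 < β - 1)) (by linarith : b ≤ 1) hc).comp s
    (hasDerivAt_inv hs0.ne')
  rw [setIntegral_mobius_beta hab hc] at hcomp
  have hloc : weightInt β a b =ᶠ[𝓝 s]
      ((fun c => ∫ t in Ioo (0 : ℝ) 1, t ^ a * (1 - t) ^ (β - 1) * (c - t) ^ b) ∘
        fun x => x⁻¹) := by
    filter_upwards [Ioo_mem_nhds hs0 hs.2] with s' hs'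
    exact weightInt_eq hab hs'
  refine (hcomp.congr_of_eventuallyEq hloc).congr_deriv ?_
  have e1 : s⁻¹ - 1 = (1 - s) * s⁻¹ := by field_simp
  rw [e1, Real.mul_rpow h1s.le (inv_pos.2 hs0).le, Real.inv_rpow hs0.le, Real.inv_rpow hs0.le,
    ← Real.rpow_neg hs0.le, ← Real.rpow_neg hs0.le]
  have p : s ^ (-b - 1) = s ^ (-(-a - 1)) * s ^ (- -β) * (s ^ 2)⁻¹ := by
    rw [← Real.rpow_natCast, ← Real.rpow_neg hs0.le, ← Real.rpow_add hs0, ← Real.rpow_add hs0]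
    congr 1
    push_cast
    linarith
  rw [p]
  ring

end WeightIntegral

section Weight

variable {a b s β θ : ℝ}

lemma setIntegral_reflect (g : ℝ → ℝ) :
    ∫ x in Ioo (0 : ℝ) 1, g (1 - x) = ∫ x in Ioo (0 : ℝ) 1, g x := by
  rw [setIntegral_Ioo_eq, setIntegral_Ioo_eq, intervalIntegral.integral_comp_sub_left]
  simp

lemma integrableOn_reflect {g : ℝ → ℝ} (h : IntegrableOn g (Ioo 0 1)) :
    IntegrableOn (fun x => g (1 - x)) (Ioo 0 1) := by
  rw [← intervalIntegrable_iff_integrableOn_Ioo_of_le zero_le_one] at h ⊢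
  simpa using (h.comp_sub_left 1).symm

/-- The adjoint of `I^β_θ` maps the weight `ρ` to the constant `c` on `(0,1)`. -/
def AdjointEqConst (β θ : ℝ) (ρ : ℝ → ℝ) (c : ℝ) : Prop :=
  ∀ s ∈ Ioo (0 : ℝ) 1, ∫ x in Ioo (0 : ℝ) 1, rieszKernel β θ (x - s) * ρ x = c

lemma memLp_two_weight (ha : -1 < 2 * a) (hb : -1 < 2 * b) :
    MemLp (fun x : ℝ => x ^ a * (1 - x) ^ b) 2 vol01 := by
  refine (memLp_two_iff_integrable_sq (integrableOn_beta (by linarith) (by linarith)).1).2 ?_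
  refine (integrableOn_beta ha hb).congr_fun (fun x hx => ?_) measurableSet_Ioo
  have h1 : 0 ≤ 1 - x := by linarith [hx.2]
  simp only
  rw [mul_comm 2 a, mul_comm 2 b, Real.rpow_mul hx.1.le, Real.rpow_mul h1, mul_pow]
  norm_cast

lemma adjoint_weight_eq (hβ : 0 < β) (ha : -1 < a) (hb : -1 < b) (hab : a + b = -β)
    (hs : s ∈ Ioo (0 : ℝ) 1) :
    ∫ x in Ioo (0 : ℝ) 1, rieszKernel β θ (x - s) * (x ^ a * (1 - x) ^ b) =
      θ / Real.Gamma β * weightInt β b a (1 - s) +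
        (1 - θ) / Real.Gamma β * weightInt β a b s := by
  have hs' : 1 - s ∈ Ioo (0 : ℝ) 1 := ⟨by linarith [hs.2], by linarith [hs.1]⟩
  have hreflect (x : ℝ) : truncPow β (x - s) * (x ^ a * (1 - x) ^ b) =
      truncPow β (1 - s - (1 - x)) * ((1 - x) ^ b * (1 - (1 - x)) ^ a) := by
    rw [sub_sub_cancel, mul_comm ((1 - x) ^ b)]
    congr 2
    ring
  have hleft := integrableOn_truncPow_mul_weight hβ ha hab hs
  have hright : IntegrableOn (fun x => truncPow β (x - s) * (x ^ a * (1 - x) ^ b)) (Ioo 0 1) := by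
    simp_rw [hreflect]
    exact integrableOn_reflect
      (integrableOn_truncPow_mul_weight hβ hb (by linarith : b + a = -β) hs')
  have hrefl : weightInt β b a (1 - s) =
      ∫ x in Ioo (0 : ℝ) 1, truncPow β (x - s) * (x ^ a * (1 - x) ^ b) := by
    simp_rw [hreflect]
    exact (setIntegral_reflect
      (fun x => truncPow β (1 - s - x) * (x ^ b * (1 - x) ^ a))).symm
  rw [hrefl, weightInt, ← integral_const_mul, ← integral_const_mul, ← integral_add
    (hright.const_mul _) (hleft.const_mul _)]
  congr 1
  ext x
  rw [rieszKernel, neg_sub]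
  ring

lemma exists_adjointEqConst_weight (hβ : 0 < β) (ha : -1 < a) (hb : -1 < b) (hab : a + b = -β)
    (h : θ * a * betaInt b (β - 1) = (1 - θ) * b * betaInt a (β - 1)) :
    ∃ c, AdjointEqConst β θ (fun x => x ^ a * (1 - x) ^ b) c := by
  let Ψ : ℝ → ℝ := fun s => θ / Real.Gamma β * weightInt β b a (1 - s) +
    (1 - θ) / Real.Gamma β * weightInt β a b s
  have hΨ : ∀ s ∈ Ioo (0 : ℝ) 1, HasDerivAt Ψ 0 s := fun s hs => by
    have hright := (hasDerivAt_weightInt hβ hb (by linarith : b + a = -β)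
      (⟨by linarith [hs.2], by linarith [hs.1]⟩ : 1 - s ∈ Ioo (0 : ℝ) 1)).comp s
      ((hasDerivAt_id s).const_sub 1)
    have hleft := hasDerivAt_weightInt hβ ha hab hs
    refine ((hright.const_mul (θ / Real.Gamma β)).add
      (hleft.const_mul ((1 - θ) / Real.Gamma β))).congr_deriv ?_
    rw [sub_sub_cancel]
    linear_combination (s ^ (-b - 1) * (1 - s) ^ (-a - 1) / Real.Gamma β) * h
  refine ⟨Ψ (1 / 2), fun s hs => (adjoint_weight_eq hβ ha hb hab hs).trans ?_⟩
  exact isOpen_Ioo.is_const_of_deriv_eq_zero isPreconnected_Ioo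
    (fun s hs => (hΨ s hs).differentiableAt.differentiableWithinAt)
    (fun s hs => (hΨ s hs).deriv) hs (by constructor <;> norm_num)

theorem exists_weight (hβ : 0 < β) (hβ' : β < 1 / 2) (hθ : 0 ≤ θ) (hθ1 : θ ≤ 1) :
    ∃ ρ : ℝ → ℝ, MemLp ρ 2 vol01 ∧ (∀ x ∈ Ioo (0 : ℝ) 1, 0 < ρ x) ∧
      ∃ c, AdjointEqConst β θ ρ c := by
  obtain ⟨a, b, ha, hb, hab, h⟩ := exists_exponents hβ (by linarith) hθ hθ1
  exact ⟨fun x => x ^ a * (1 - x) ^ b, memLp_two_weight (by linarith) (by linarith),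
    fun x hx => mul_pos (Real.rpow_pos_of_pos hx.1 _) (Real.rpow_pos_of_pos (by linarith [hx.2]) _),
    exists_adjointEqConst_weight hβ (by linarith) (by linarith) hab h⟩

end Weight

/-! ### The fractional integral of a square-integrable function -/

section FractionalIntegral

variable {β θ : ℝ} {φ u w ρ : ℝ → ℝ}

lemma rieszConv_eq_integral_sub (β θ : ℝ) (w : ℝ → ℝ) (x : ℝ) :
    rieszConv β θ w x = ∫ s, rieszKernel β θ (x - s) * w s := by
  rw [rieszConv, ← integral_sub_left_eq_self _ volume x]
  simp only [sub_sub_cancel]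

lemma rieszConv_indicator (β θ : ℝ) (w : ℝ → ℝ) (x : ℝ) :
    rieszConv β θ ((Ioo 0 1).indicator w) x =
      ∫ s in Ioo (0 : ℝ) 1, rieszKernel β θ (x - s) * w s := by
  rw [rieszConv_eq_integral_sub, ← integral_indicator measurableSet_Ioo]
  simp only [indicator_mul_right]

lemma rieszKernel_of_pos {t : ℝ} (ht : t ∈ Ioo (0 : ℝ) 1) :
    rieszKernel β θ t = θ / Real.Gamma β * t ^ (β - 1) := by
  have hneg : -t ∉ Ioo (0 : ℝ) 1 := fun h => by linarith [h.1, ht.1]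
  simp [rieszKernel, truncPow, indicator_of_mem ht, indicator_of_notMem hneg]

lemma rieszKernel_of_neg {t : ℝ} (ht : -t ∈ Ioo (0 : ℝ) 1) :
    rieszKernel β θ t = (1 - θ) / Real.Gamma β * (-t) ^ (β - 1) := by
  have hpos : t ∉ Ioo (0 : ℝ) 1 := fun h => by linarith [h.1, ht.1]
  simp [rieszKernel, truncPow, indicator_of_mem ht, indicator_of_notMem hpos]

lemma iTheta_eq_setIntegral {x : ℝ} (hx : x ∈ Ioo (0 : ℝ) 1)
    (hi : IntegrableOn (fun s => rieszKernel β θ (x - s) * w s) (Ioo 0 1)) :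
    iTheta β θ w x = ∫ s in Ioo (0 : ℝ) 1, rieszKernel β θ (x - s) * w s := by
  have hi01 := intervalIntegrable_zero_one_iff.2 hi
  have hx01 : x ∈ uIcc (0 : ℝ) 1 := uIcc_of_le (zero_le_one' ℝ) ▸ Ioo_subset_Icc_self hx
  rw [setIntegral_Ioo_eq, iTheta, leftI, rightI, ← mul_assoc, ← mul_assoc,
    ← intervalIntegral.integral_const_mul, ← intervalIntegral.integral_const_mul,
    ← intervalIntegral.integral_add_adjacent_intervals
      (hi01.mono_set (uIcc_subset_uIcc_left hx01)) (hi01.mono_set (uIcc_subset_uIcc_right hx01))]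
  congr 1
  · refine intervalIntegral.integral_congr_Ioo_of_le hx.1.le fun s hs => ?_
    rw [rieszKernel_of_pos ⟨by linarith [hs.2], by linarith [hs.1, hx.2]⟩, ← neg_sub 1 β,
      Real.rpow_neg (by linarith [hs.2])]
    ring
  · refine intervalIntegral.integral_congr_Ioo_of_le hx.2.le fun s hs => ?_
    rw [rieszKernel_of_neg ⟨by linarith [hs.1], by linarith [hs.2, hx.1]⟩, neg_sub, ← neg_sub 1 β,
      Real.rpow_neg (by linarith [hs.1])]
    ring

lemma ae_integrable_rieszKernel_mul (hβ : 0 < β) (θ : ℝ) (hw : Integrable w) :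
    ∀ᵐ x, Integrable fun s => rieszKernel β θ (x - s) * w s := by
  filter_upwards [Integrable.ae_convolution_exists (ContinuousLinearMap.mul ℝ ℝ)
    (integrable_rieszKernel hβ θ) hw] with x hx
  exact hx.integrable_swap

lemma iTheta_ae_eq_rieszConv (hβ : 0 < β) (θ : ℝ) (hu : IntegrableOn u (Ioo 0 1)) :
    iTheta β θ u =ᵐ[vol01] rieszConv β θ ((Ioo 0 1).indicator u) := by
  refine (ae_restrict_iff' measurableSet_Ioo).2 ?_
  filter_upwards [ae_integrable_rieszKernel_mul hβ θ
    (hu.integrable_indicator measurableSet_Ioo)] with x hx hx01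
  have hint := hx.integrableOn (s := Ioo 0 1)
  rw [rieszConv_indicator]
  refine iTheta_eq_setIntegral hx01 (hint.congr_fun (fun s hs => ?_) measurableSet_Ioo)
  simp only [indicator_of_mem hs]

lemma integrable_rieszConv (hβ : 0 < β) (θ : ℝ) (hw : Integrable w) :
    Integrable (rieszConv β θ w) := by
  rw [rieszConv_eq_convolution]
  exact (integrable_rieszKernel hβ θ).integrable_convolution _ hw

lemma rieszConv_sub_ae_eq (hβ : 0 < β) (θ : ℝ) {w' : ℝ → ℝ} (hw : Integrable w)
    (hw' : Integrable w') :
    rieszConv β θ (w - w') =ᵐ[volume] rieszConv β θ w - rieszConv β θ w' := by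
  filter_upwards [ae_integrable_rieszKernel_mul hβ θ hw,
    ae_integrable_rieszKernel_mul hβ θ hw'] with x hx hx'
  simp only [Pi.sub_apply, rieszConv_eq_integral_sub, mul_sub]
  exact integral_sub hx hx'

lemma integral_abs_rieszConv_le (hβ : 0 < β) (θ : ℝ) (hw : Integrable w) :
    ∫ x, |rieszConv β θ w x| ≤ (∫ t, |rieszKernel β θ t|) * ∫ x, |w x| := by
  have hk := (integrable_rieszKernel hβ θ).abs
  have hfubini := integral_convolution (ContinuousLinearMap.mul ℝ ℝ) (μ := volume) (ν := volume)
    hk hw.abs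
  rw [ContinuousLinearMap.mul_apply'] at hfubini
  rw [← hfubini]
  refine integral_mono (integrable_rieszConv hβ θ hw).abs (hk.integrable_convolution _ hw.abs)
    fun x => ?_
  rw [convolution_def]
  exact abs_integral_le_integral_abs.trans_eq (by simp [abs_mul])

lemma integrableOn_iTheta (hβ : 0 < β) (θ : ℝ) (hu : IntegrableOn u (Ioo 0 1)) :
    IntegrableOn (iTheta β θ u) (Ioo 0 1) :=
  (integrable_rieszConv hβ θ (hu.integrable_indicator measurableSet_Ioo)).integrableOn.congr_fun_ae
    (iTheta_ae_eq_rieszConv hβ θ hu).symm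

lemma IsTest.integral_abs_rieszConv_sub_iTheta_le (hβ : 0 < β) (θ : ℝ) (h : IsTest φ)
    (hu : IntegrableOn u (Ioo 0 1)) :
    ∫ x in Ioo (0 : ℝ) 1, |rieszConv β θ φ x - iTheta β θ u x| ≤
      (∫ t, |rieszKernel β θ t|) * ∫ x in Ioo (0 : ℝ) 1, |φ x - u x| := by
  have hU := hu.integrable_indicator measurableSet_Ioo
  have hsub : ∫ x, |(φ - (Ioo 0 1).indicator u) x| = ∫ x in Ioo (0 : ℝ) 1, |φ x - u x| := by
    rw [← integral_indicator measurableSet_Ioo]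
    congr 1 with x
    by_cases hx : x ∈ Ioo (0 : ℝ) 1
    · simp [indicator_of_mem hx]
    · simp [indicator_of_notMem hx, h.eq_zero hx]
  calc ∫ x in Ioo (0 : ℝ) 1, |rieszConv β θ φ x - iTheta β θ u x|
      = ∫ x in Ioo (0 : ℝ) 1, |rieszConv β θ (φ - (Ioo 0 1).indicator u) x| := by
        refine integral_congr_ae ?_
        filter_upwards [iTheta_ae_eq_rieszConv hβ θ hu,
          ae_restrict_of_ae (rieszConv_sub_ae_eq hβ θ h.integrable hU)] with x hx hx'
        rw [hx, hx', Pi.sub_apply]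
    _ ≤ ∫ x, |rieszConv β θ (φ - (Ioo 0 1).indicator u) x| :=
        setIntegral_le_integral (integrable_rieszConv hβ θ (h.integrable.sub hU)).abs
          (ae_of_all _ fun x => abs_nonneg _)
    _ ≤ _ := (integral_abs_rieszConv_le hβ θ (h.integrable.sub hU)).trans_eq (by rw [hsub])

end FractionalIntegral

/-! ### Pairing with a weight of constant adjoint -/

section Moments

variable {β θ c : ℝ} {φ ρ : ℝ → ℝ}

lemma integral_rieszConv_mul (hβ : 0 < β) (θ : ℝ) {w : ℝ → ℝ} {C : ℝ}
    (hw : AEStronglyMeasurable w) (hC : ∀ x, |w x| ≤ C) {ν : Measure ℝ} [SFinite ν]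
    (hρ : Integrable ρ ν) :
    ∫ x, rieszConv β θ w x * ρ x ∂ν = ∫ s, w s * ∫ x, rieszKernel β θ (x - s) * ρ x ∂ν := by
  have hkρ : Integrable (fun p : ℝ × ℝ => ρ p.2 * rieszKernel β θ (p.2 - p.1))
      (volume.prod ν) := by
    simpa using Integrable.convolution_integrand (ContinuousLinearMap.mul ℝ ℝ) hρ
      (integrable_rieszKernel hβ θ).comp_neg
  have hprod : Integrable (fun p : ℝ × ℝ => w p.1 * (rieszKernel β θ (p.2 - p.1) * ρ p.2))
      (volume.prod ν) :=
    (hkρ.bdd_mul hw.comp_fst (ae_of_all _ fun p => hC p.1)).congr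
      (ae_of_all _ fun p => by ring)
  simp_rw [rieszConv_eq_integral_sub, ← integral_mul_const, ← integral_const_mul]
  rw [integral_integral_swap (f := fun s x => w s * (rieszKernel β θ (x - s) * ρ x)) hprod]
  congr with x
  congr with s
  ring

lemma IsTest.integral_rieszConv_mul (hβ : 0 < β) (h : IsTest φ)
    (hρ : IntegrableOn ρ (Ioo 0 1)) (hc : AdjointEqConst β θ ρ c) :
    ∫ x in Ioo (0 : ℝ) 1, rieszConv β θ φ x * ρ x = c * ∫ s, φ s := by
  obtain ⟨C, hC⟩ := h.exists_abs_le
  rw [FracDiff.integral_rieszConv_mul hβ θ h.continuous.aestronglyMeasurable hC hρ,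
    ← integral_const_mul]
  congr with s
  by_cases hs : s ∈ Ioo (0 : ℝ) 1
  · rw [hc s hs, mul_comm]
  · simp only [h.eq_zero hs, zero_mul, mul_zero]

lemma integral_truncPow_mul (β : ℝ) (f : ℝ → ℝ) :
    ∫ t, truncPow β t * f t = ∫ t in (0 : ℝ)..1, t ^ (β - 1) * f t := by
  simp only [← setIntegral_Ioo_eq, ← integral_indicator measurableSet_Ioo, truncPow,
    indicator_mul_left]

lemma intervalIntegrable_rpow_mul (hβ : 0 < β) {f : ℝ → ℝ} (hf : Continuous f) :
    IntervalIntegrable (fun t => t ^ (β - 1) * f t) volume 0 1 :=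
  (intervalIntegral.intervalIntegrable_rpow' (by linarith)).mul_continuousOn hf.continuousOn

lemma integrable_truncPow_mul (hβ : 0 < β) {f : ℝ → ℝ} (hf : Continuous f) :
    Integrable fun t => truncPow β t * f t := by
  simp only [truncPow, ← indicator_mul_left]
  exact (intervalIntegrable_zero_one_iff.1
    (intervalIntegrable_rpow_mul hβ hf)).integrable_indicator measurableSet_Ioo

lemma integrable_truncPow_neg_mul (hβ : 0 < β) {f : ℝ → ℝ} (hf : Continuous f) :
    Integrable fun t => truncPow β (-t) * f t := by
  simpa using (integrable_truncPow_mul hβ (hf.comp continuous_neg)).comp_neg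

lemma rieszKernel_mul (β θ : ℝ) (f : ℝ → ℝ) (t : ℝ) :
    rieszKernel β θ t * f t = θ / Real.Gamma β * (truncPow β t * f t) +
      (1 - θ) / Real.Gamma β * (truncPow β (-t) * f t) := by
  rw [rieszKernel]
  ring

lemma integrable_rieszKernel_mul (hβ : 0 < β) (θ : ℝ) {f : ℝ → ℝ} (hf : Continuous f) :
    Integrable fun t => rieszKernel β θ t * f t := by
  simp only [rieszKernel_mul]
  exact ((integrable_truncPow_mul hβ hf).const_mul _).add
    ((integrable_truncPow_neg_mul hβ hf).const_mul _)

lemma integral_rieszKernel_mul (hβ : 0 < β) (θ : ℝ) {f : ℝ → ℝ} (hf : Continuous f) :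
    ∫ t, rieszKernel β θ t * f t = θ / Real.Gamma β * (∫ t, truncPow β t * f t) +
      (1 - θ) / Real.Gamma β * ∫ t, truncPow β t * f (-t) := by
  have hreflect := integral_neg_eq_self (fun t => truncPow β t * f (-t)) volume
  simp only [neg_neg] at hreflect
  simp only [rieszKernel_mul]
  rw [integral_add ((integrable_truncPow_mul hβ hf).const_mul _)
    ((integrable_truncPow_neg_mul hβ hf).const_mul _), integral_const_mul, integral_const_mul,
    hreflect]

lemma integral_truncPow_euler (hβ : 0 < β) {ψ : ℝ → ℝ} (hψ : ContDiff ℝ 1 ψ) (h1 : ψ 1 = 0) :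
    ∫ t, truncPow β t * (t * deriv ψ t) = -β * ∫ t, truncPow β t * ψ t := by
  have hint₁ := intervalIntegrable_rpow_mul hβ (f := fun t => t * deriv ψ t)
    (continuous_id.mul (hψ.continuous_deriv le_rfl))
  have hint₂ := (intervalIntegrable_rpow_mul hβ hψ.continuous).const_mul β
  have hderiv : ∀ t ∈ Ioo (0 : ℝ) 1, HasDerivAt (fun t => t ^ β * ψ t)
      (t ^ (β - 1) * (t * deriv ψ t) + β * (t ^ (β - 1) * ψ t)) t := fun t ht => by
    have hmul := (Real.hasDerivAt_rpow_const (p := β) (Or.inl ht.1.ne')).mul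
      (hψ.differentiable one_ne_zero t).hasDerivAt
    have hpow : t ^ β = t ^ (β - 1) * t := by
      rw [← Real.rpow_add_one ht.1.ne', sub_add_cancel]
    refine hmul.congr_deriv ?_
    rw [hpow]
    ring
  have hFTC := intervalIntegral.integral_eq_sub_of_hasDerivAt_of_le zero_le_one
    ((Real.continuous_rpow_const hβ.le).mul hψ.continuous).continuousOn hderiv (hint₁.add hint₂)
  simp only [Pi.mul_apply] at hFTC
  rw [intervalIntegral.integral_add hint₁ hint₂, intervalIntegral.integral_const_mul, h1,
    Real.zero_rpow hβ.ne'] at hFTC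
  rw [integral_truncPow_mul, integral_truncPow_mul]
  linarith

lemma IsTest.rieszConv_mul_deriv (hβ : 0 < β) (θ : ℝ) (h : IsTest φ) {x : ℝ}
    (hx : x ∈ Ioo (0 : ℝ) 1) :
    rieszConv β θ (fun s => s * deriv φ s) x =
      x * rieszConv β θ (deriv φ) x - β * rieszConv β θ φ x := by
  have := h.continuous
  have := h.deriv.continuous
  have hC1 : ContDiff ℝ 1 φ := h.1.of_le (by simp)
  have hleft := integral_truncPow_euler hβ (ψ := fun t => φ (x - t))
    (hC1.comp (contDiff_const.sub contDiff_id)) (h.eq_zero fun h0 => by linarith [h0.1, hx.2])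
  have hright := integral_truncPow_euler hβ (ψ := fun t => φ (x + t))
    (hC1.comp (contDiff_const.add contDiff_id)) (h.eq_zero fun h0 => by linarith [h0.2, hx.1])
  simp only [deriv_comp_const_sub] at hleft
  simp only [deriv_comp_const_add] at hright
  have heuler : ∫ t, rieszKernel β θ t * (t * deriv φ (x - t)) = β * rieszConv β θ φ x := by
    rw [rieszConv, integral_rieszKernel_mul hβ θ (by fun_prop),
      integral_rieszKernel_mul hβ θ (by fun_prop)]
    simp only [sub_neg_eq_add, neg_mul, mul_neg, integral_neg] at hleft hright ⊢
    rw [hright, neg_inj.1 hleft]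
    ring
  rw [← heuler, rieszConv, rieszConv, ← integral_const_mul, ← integral_sub
    ((integrable_rieszKernel_mul hβ θ (by fun_prop)).const_mul _)
    (integrable_rieszKernel_mul hβ θ (by fun_prop))]
  congr with t
  ring

lemma IsTest.integral_deriv_eq_zero (h : IsTest φ) : ∫ s, deriv φ s = 0 :=
  integral_eq_zero_of_hasDerivAt_of_integrable (fun x => (h.differentiable x).hasDerivAt)
    h.deriv.integrable h.integrable

lemma IsTest.integral_mul_deriv (h : IsTest φ) : ∫ s, s * deriv φ s = -∫ s, φ s := by
  have hparts := integral_mul_deriv_eq_deriv_mul_of_integrable (u := fun s : ℝ => s)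
    (u' := fun _ => 1) (v := φ) (v' := deriv φ) (fun x _ => hasDerivAt_id x)
    (fun x _ => (h.differentiable x).hasDerivAt) (h.deriv.contDiff_mul contDiff_id).integrable
    (by simpa [Pi.mul_def] using h.integrable) (h.contDiff_mul contDiff_id).integrable
  simpa using hparts

lemma IsTest.integral_rieszConv_deriv_mul (hβ : 0 < β) (h : IsTest φ)
    (hρ : IntegrableOn ρ (Ioo 0 1)) (hc : AdjointEqConst β θ ρ c) :
    ∫ x in Ioo (0 : ℝ) 1, rieszConv β θ (deriv φ) x * ρ x = 0 := by
  rw [h.deriv.integral_rieszConv_mul hβ hρ hc, h.integral_deriv_eq_zero, mul_zero]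

lemma IsTest.integrableOn_rieszConv_mul (hβ : 0 < β) (θ : ℝ) (h : IsTest φ)
    (hρ : IntegrableOn ρ (Ioo 0 1)) :
    IntegrableOn (fun x => rieszConv β θ φ x * ρ x) (Ioo 0 1) := by
  have hcont := (h.contDiff_rieszConv hβ θ).continuous
  obtain ⟨C, hC⟩ := hcont.bounded_above_of_compact_support (h.hasCompactSupport_rieszConv β θ)
  exact hρ.bdd_mul hcont.aestronglyMeasurable (ae_of_all _ hC)

lemma IsTest.integral_rieszConv_mul_eq_neg (hβ : 0 < β) (h : IsTest φ)
    (hρ : IntegrableOn ρ (Ioo 0 1)) (hc : AdjointEqConst β θ ρ c) :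
    (1 - β) * ∫ x in Ioo (0 : ℝ) 1, rieszConv β θ φ x * ρ x =
      -∫ x in Ioo (0 : ℝ) 1, rieszConv β θ (deriv φ) x * (x * ρ x) := by
  have hxρ : IntegrableOn (fun x => x * ρ x) (Ioo 0 1) :=
    hρ.continuousOn_mul_of_subset continuousOn_id isCompact_Icc measurableSet_Ioo
      Ioo_subset_Icc_self
  have hmean := h.integral_rieszConv_mul hβ hρ hc
  have hEuler := (h.deriv.contDiff_mul contDiff_id).integral_rieszConv_mul hβ hρ hc
  simp only [id, h.integral_mul_deriv] at hEuler
  have hcommutator : ∫ x in Ioo (0 : ℝ) 1, rieszConv β θ (fun s => s * deriv φ s) x * ρ x =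
      (∫ x in Ioo (0 : ℝ) 1, rieszConv β θ (deriv φ) x * (x * ρ x)) -
        β * ∫ x in Ioo (0 : ℝ) 1, rieszConv β θ φ x * ρ x := by
    rw [← integral_const_mul, ← integral_sub (h.deriv.integrableOn_rieszConv_mul hβ θ hxρ)
      ((h.integrableOn_rieszConv_mul hβ θ hρ).const_mul β)]
    refine setIntegral_congr_fun measurableSet_Ioo fun x hx => ?_
    rw [h.rieszConv_mul_deriv hβ θ hx]
    ring
  linarith

end Moments

/-! ### The fractional integral on the fractional Sobolev space -/

section Approximation

variable {β c : ℝ} {φ u w w' g ρ : ℝ → ℝ}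

lemma IsTest.memLp (h : IsTest φ) : MemLp φ 2 vol01 :=
  (h.continuous.memLp_of_hasCompactSupport h.2.1).restrict _

lemma IsTest.hasWeakDeriv_deriv (h : IsTest φ) : HasWeakDeriv 1 φ (deriv φ) :=
  hasWeakDeriv_of_absolutelyContinuousOnInterval
    (h.1.of_le (by simp)).contDiffOn.absolutelyContinuousOnInterval

lemma IsTest.hasWeakDeriv_rieszConv (hβ : 0 < β) (θ : ℝ) (h : IsTest φ) :
    HasWeakDeriv 1 (rieszConv β θ φ) (rieszConv β θ (deriv φ)) := by
  rw [← funext fun x => (h.hasDerivAt_rieszConv hβ θ x).deriv]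
  exact hasWeakDeriv_of_absolutelyContinuousOnInterval
    ((h.contDiff_rieszConv hβ θ).of_le (by simp)).contDiffOn.absolutelyContinuousOnInterval

lemma IsTest.memLp_rieszConv (hβ : 0 < β) (θ : ℝ) (h : IsTest φ) :
    MemLp (rieszConv β θ φ) 2 vol01 :=
  ((h.contDiff_rieszConv hβ θ).continuous.memLp_of_hasCompactSupport
    (h.hasCompactSupport_rieszConv β θ)).restrict _

lemma rieszConv_sub (hβ : 0 < β) (θ : ℝ) (hw : Continuous w) (hw' : Continuous w') :
    rieszConv β θ (fun x => w x - w' x) = fun x => rieszConv β θ w x - rieszConv β θ w' x := by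
  funext x
  simp_rw [rieszConv, mul_sub]
  exact integral_sub (integrable_rieszKernel_mul hβ θ (hw.comp (continuous_sub_left x)))
    (integrable_rieszKernel_mul hβ θ (hw'.comp (continuous_sub_left x)))

lemma exists_tendsto_rieszConv_deriv (hβ : 0 < β) (hβ1 : β ≤ 1) (θ : ℝ) {φ : ℕ → ℝ → ℝ}
    (hφ : ∀ n, IsTest (φ n))
    (hcauchy : ∀ ε > 0, ∃ N, ∀ i ≥ N, ∀ j ≥ N, fracNorm (1 - β) (fun x => φ i x - φ j x) < ε) :
    ∃ g, MemLp g 2 vol01 ∧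
      Tendsto (fun n => l2Norm (fun x => rieszConv β θ (deriv (φ n)) x - g x)) atTop (𝓝 0) := by
  obtain ⟨C, hC0, hC⟩ := exists_l2Norm_rieszConv_deriv_le hβ hβ1 θ
  refine exists_tendsto_l2Norm_of_cauchy (fun n => (hφ n).deriv.memLp_rieszConv hβ θ)
    fun ε hε => ?_
  obtain ⟨N, hN⟩ := hcauchy (ε / (C + 1)) (by positivity)
  refine ⟨N, fun i hi j hj => ?_⟩
  have hsub : deriv (fun x => φ i x - φ j x) = fun x => deriv (φ i) x - deriv (φ j) x :=
    funext fun x => deriv_fun_sub ((hφ i).differentiable x) ((hφ j).differentiable x)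
  rw [← rieszConv_sub hβ θ (hφ i).deriv.continuous (hφ j).deriv.continuous, ← hsub]
  calc l2Norm (rieszConv β θ (deriv fun x => φ i x - φ j x))
      ≤ C * fracNorm (1 - β) (fun x => φ i x - φ j x) := hC _ ((hφ i).sub (hφ j))
    _ ≤ C * (ε / (C + 1)) := mul_le_mul_of_nonneg_left (hN i hi j hj).le hC0
    _ < (C + 1) * (ε / (C + 1)) := mul_lt_mul_of_pos_right (lt_add_one C) (by positivity)
    _ = ε := mul_div_cancel₀ ε (by positivity)

lemma tendsto_integral_abs_of_tendsto_l2Norm {d : ℕ → ℝ → ℝ} (hd : ∀ n, MemLp (d n) 2 vol01)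
    (hg : MemLp g 2 vol01)
    (h : Tendsto (fun n => l2Norm (fun x => d n x - g x)) atTop (𝓝 0)) :
    Tendsto (fun n => ∫ x in Ioo (0 : ℝ) 1, |d n x - g x|) atTop (𝓝 0) :=
  squeeze_zero (fun _ => integral_nonneg fun _ => abs_nonneg _)
    (fun n => integral_abs_le_l2Norm ((hd n).sub hg)) h

lemma HasWeakDeriv.tendsto_l2Norm {wn gn : ℕ → ℝ → ℝ}
    (hn : ∀ n, HasWeakDeriv 1 (wn n) (gn n)) (h : HasWeakDeriv 1 w g)
    (hwn : ∀ n, IntegrableOn (wn n) (Ioo 0 1)) (hw : IntegrableOn w (Ioo 0 1))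
    (hgn : ∀ n, MemLp (gn n) 2 vol01) (hg : MemLp g 2 vol01)
    (hwlim : Tendsto (fun n => ∫ x in Ioo (0 : ℝ) 1, |wn n x - w x|) atTop (𝓝 0))
    (hglim : Tendsto (fun n => l2Norm (fun x => gn n x - g x)) atTop (𝓝 0)) :
    Tendsto (fun n => l2Norm (fun x => wn n x - w x)) atTop (𝓝 0) := by
  refine squeeze_zero (fun _ => l2Norm_nonneg _) (fun n => l2Norm_le_of_ae_abs_le ?_
    (((hn n).sub h).ae_abs_le ((hwn n).sub hw) ((hgn n).sub hg)))
    (by simpa using hwlim.add (hglim.const_mul 2))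
  exact add_nonneg (integral_nonneg fun _ => abs_nonneg _)
    (mul_nonneg zero_le_two (l2Norm_nonneg _))

lemma HasWeakDeriv.memLp (h : HasWeakDeriv 1 w g) (hw : IntegrableOn w (Ioo 0 1))
    (hg : MemLp g 2 vol01) : MemLp w 2 vol01 :=
  MemLp.of_bound hw.aestronglyMeasurable _ (h.ae_abs_le hw hg)

theorem MemH0.exists_approximation (hβ : 0 < β) (hβ1 : β ≤ 1) (θ : ℝ) (hu : MemH0 (1 - β) u) :
    ∃ g, HasWeakDeriv 1 (iTheta β θ u) g ∧ MemLp g 2 vol01 ∧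
      ∃ φ : ℕ → ℝ → ℝ, (∀ n, IsTest (φ n)) ∧
        Tendsto (fun n => l2Norm (fun x => rieszConv β θ (φ n) x - iTheta β θ u x)) atTop (𝓝 0) ∧
        Tendsto (fun n => l2Norm (fun x => rieszConv β θ (deriv (φ n)) x - g x)) atTop (𝓝 0) := by
  obtain ⟨hu2, φ, hφ, hcauchy, hlim⟩ := hu
  obtain ⟨g, hg, hglim⟩ := exists_tendsto_rieszConv_deriv hβ hβ1 θ hφ hcauchy
  have hu1 := integrableOn_of_memLp hu2
  have hI := integrableOn_iTheta hβ θ hu1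
  have hwn n := integrableOn_of_memLp ((hφ n).memLp_rieszConv hβ θ)
  have hgn n := (hφ n).deriv.memLp_rieszConv hβ θ
  have hderiv n := (hφ n).hasWeakDeriv_rieszConv hβ θ
  have hwlim : Tendsto (fun n => ∫ x in Ioo (0 : ℝ) 1, |rieszConv β θ (φ n) x - iTheta β θ u x|)
      atTop (𝓝 0) :=
    squeeze_zero (fun _ => integral_nonneg fun _ => abs_nonneg _)
      (fun n => (hφ n).integral_abs_rieszConv_sub_iTheta_le hβ θ hu1)
      (by simpa using
        (tendsto_integral_abs_of_tendsto_l2Norm (fun n => (hφ n).memLp) hu2 hlim).const_mul _)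
  have hweak : HasWeakDeriv 1 (iTheta β θ u) g :=
    .of_tendsto_L1 hderiv hwn (fun n => integrableOn_of_memLp (hgn n)) hI
      (integrableOn_of_memLp hg) hwlim (tendsto_integral_abs_of_tendsto_l2Norm hgn hg hglim)
  exact ⟨g, hweak, hg, φ, hφ,
    HasWeakDeriv.tendsto_l2Norm hderiv hweak hwn hI hgn hg hwlim hglim, hglim⟩

theorem MemH0.exists_hasWeakDeriv_moments {θ : ℝ} (hβ : 0 < β) (hβ1 : β ≤ 1)
    (hρ : MemLp ρ 2 vol01) (hc : AdjointEqConst β θ ρ c) (hu : MemH0 (1 - β) u) :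
    ∃ g, HasWeakDeriv 1 (iTheta β θ u) g ∧ MemLp g 2 vol01 ∧
      ∫ x in Ioo (0 : ℝ) 1, g x * ρ x = 0 ∧
      (1 - β) * ∫ x in Ioo (0 : ℝ) 1, iTheta β θ u x * ρ x =
        -∫ x in Ioo (0 : ℝ) 1, g x * (x * ρ x) := by
  obtain ⟨g, hweak, hg, φ, hφ, hlim, hlim'⟩ := hu.exists_approximation hβ hβ1 θ
  have hI : MemLp (iTheta β θ u) 2 vol01 :=
    hweak.memLp (integrableOn_iTheta hβ θ (integrableOn_of_memLp hu.1)) hg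
  have hρ1 := integrableOn_of_memLp hρ
  obtain ⟨_, -, hmul⟩ := exists_l2Norm_continuousOn_mul_le (R := fun x => x) continuousOn_id
  have hgn n := (hφ n).deriv.memLp_rieszConv hβ θ
  refine ⟨g, hweak, hg, ?_, ?_⟩
  · refine tendsto_nhds_unique (tendsto_integral_mul_of_tendsto_l2Norm hgn hg hρ hlim') ?_
    simp_rw [fun n => (hφ n).integral_rieszConv_deriv_mul hβ hρ1 hc]
    exact tendsto_const_nhds
  · refine tendsto_nhds_unique ((tendsto_integral_mul_of_tendsto_l2Norm
      (fun n => (hφ n).memLp_rieszConv hβ θ) hI hρ hlim).const_mul (1 - β)) ?_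
    simp_rw [fun n => (hφ n).integral_rieszConv_mul_eq_neg hβ hρ1 hc]
    exact (tendsto_integral_mul_of_tendsto_l2Norm hgn hg (hmul ρ hρ).1 hlim').neg

end Approximation

/-! ### Weak solutions -/

section WeakSolution

variable {β θ κ G Km : ℝ} {K F f g u v w ρ : ℝ → ℝ}

lemma IsTest.memH0 (h : IsTest v) (μ : ℝ) : MemH0 μ v := by
  have hzero : 𝓕 (fun _ : ℝ => (0 : ℂ)) = 0 := by
    ext ξ
    simp [Real.fourier_eq]
  exact ⟨h.memLp, fun _ => v, fun _ => h,
    fun ε hε => ⟨0, fun _ _ _ _ => by simpa [fracNorm, hzero] using hε⟩, by simp [l2Norm]⟩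

lemma IsWeakSolution.hasWeakDeriv_flux (h : IsWeakSolution β θ K f u)
    (hK : ContinuousOn K (Icc 0 1)) (hf : IntegrableOn f (Ioo 0 1)) (hg : IntegrableOn g (Ioo 0 1))
    (hug : HasWeakDeriv 1 (iTheta β θ u) g) :
    HasWeakDeriv 1 (fun x => K x * g x) (fun x => -f x) := by
  refine ⟨(hg.continuousOn_mul_of_subset hK isCompact_Icc measurableSet_Ioo
    Ioo_subset_Icc_self).locallyIntegrableOn, hf.neg.locallyIntegrableOn, fun φ hφ => ?_⟩
  have htest : ∫ x in Ioo (0 : ℝ) 1, K x * weakDeriv 1 (iTheta β θ u) x * weakDeriv 1 φ x =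
      ∫ x in Ioo (0 : ℝ) 1, K x * g x * deriv φ x := integral_congr_ae (by
    filter_upwards [hφ.hasWeakDeriv_deriv.weakDeriv_ae_eq, hug.weakDeriv_ae_eq] with x hφx hux
    rw [hφx, hux])
  rw [iteratedDeriv_one, ← htest, h.2 φ (hφ.memH0 1)]
  simp [integral_neg]

lemma integral_pos_of_pos (hw : IntegrableOn w (Ioo 0 1)) (hpos : ∀ x ∈ Ioo (0 : ℝ) 1, 0 < w x) :
    0 < ∫ x in Ioo (0 : ℝ) 1, w x := by
  rw [setIntegral_pos_iff_support_of_nonneg_ae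
    (ae_restrict_of_forall_mem measurableSet_Ioo fun x hx => (hpos x hx).le) hw,
    inter_eq_right.2 fun x hx => Function.mem_support.2 (hpos x hx).ne']
  simp

lemma abs_le_of_integral_const_add_mul_eq_zero {α : Type*} [MeasurableSpace α] {μ : Measure α}
    {h w : α → ℝ} {b N : ℝ} (hw : Integrable w μ) (hw0 : 0 ≤ᵐ[μ] w) (hpos : 0 < ∫ x, w x ∂μ)
    (hm : AEStronglyMeasurable h μ) (hN : ∀ᵐ x ∂μ, |h x| ≤ N)
    (hzero : ∫ x, (b + h x) * w x ∂μ = 0) : |b| ≤ N := by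
  have hb : b * ∫ x, w x ∂μ = -∫ x, h x * w x ∂μ := by
    simp_rw [add_mul] at hzero
    rw [integral_add (hw.const_mul b) (hw.bdd_mul hm hN), integral_const_mul] at hzero
    exact eq_neg_of_add_eq_zero_left hzero
  refine le_of_mul_le_mul_right ?_ hpos
  calc |b| * ∫ x, w x ∂μ = |∫ x, h x * w x ∂μ| := by
        rw [← abs_neg (∫ x, h x * w x ∂μ), ← hb, abs_mul, abs_of_pos hpos]
    _ ≤ ∫ x, N * w x ∂μ := by
        refine abs_integral_le_integral_abs.trans (integral_mono_of_nonneg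
          (ae_of_all _ fun x => abs_nonneg _) (hw.const_mul N) ?_)
        filter_upwards [hN, hw0] with x hx hwx
        rw [abs_mul, abs_of_nonneg hwx]
        exact mul_le_mul_of_nonneg_right hx hwx
    _ = N * ∫ x, w x ∂μ := integral_const_mul N w

lemma aestronglyMeasurable_primitive (hg : IntegrableOn g (Ioo 0 1)) :
    AEStronglyMeasurable (fun x => ∫ s in (0 : ℝ)..x, g s) vol01 := by
  have hcont := (absolutelyContinuousOnInterval_primitive hg 0).continuousOn
  rw [uIcc_of_le zero_le_one] at hcont
  simpa only [zero_add, vol01] using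
    (hcont.mono Ioo_subset_Icc_self).aestronglyMeasurable measurableSet_Ioo

lemma ae_abs_flux_le (hKc : ContinuousOn K (Icc 0 1)) (hK : ∀ x ∈ Icc (0 : ℝ) 1, 0 < K x)
    (hρ : IntegrableOn ρ (Ioo 0 1)) (hρ0 : ∀ x ∈ Ioo (0 : ℝ) 1, 0 < ρ x)
    (hflux : HasWeakDeriv 1 (fun x => K x * g x) F) (hF : MemLp F 2 vol01)
    (hmean : ∫ x in Ioo (0 : ℝ) 1, g x * ρ x = 0) :
    ∀ᵐ x ∂vol01, |K x * g x| ≤ 2 * l2Norm F := by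
  have hF1 := integrableOn_of_memLp hF
  obtain ⟨b, hb⟩ := hflux.exists_ae_eq_primitive hF1
  have hprim : ∀ᵐ x ∂vol01, |∫ s in (0 : ℝ)..x, F s| ≤ l2Norm F :=
    ae_restrict_of_forall_mem measurableSet_Ioo fun x hx => abs_primitive_le_l2Norm hF hx
  have hwpos : ∀ x ∈ Ioo (0 : ℝ) 1, 0 < (K x)⁻¹ * ρ x := fun x hx =>
    mul_pos (inv_pos.2 (hK x (Ioo_subset_Icc_self hx))) (hρ0 x hx)
  have hw : IntegrableOn (fun x => (K x)⁻¹ * ρ x) (Ioo 0 1) :=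
    hρ.continuousOn_mul_of_subset (hKc.inv₀ fun x hx => (hK x hx).ne') isCompact_Icc
      measurableSet_Ioo Ioo_subset_Icc_self
  have hbF : |b| ≤ l2Norm F := by
    refine abs_le_of_integral_const_add_mul_eq_zero (μ := vol01) hw
      (ae_restrict_of_forall_mem measurableSet_Ioo fun x hx => (hwpos x hx).le)
      (integral_pos_of_pos hw hwpos) (aestronglyMeasurable_primitive hF1) hprim ?_
    refine (integral_congr_ae ?_).trans hmean
    filter_upwards [hb, ae_restrict_mem measurableSet_Ioo] with x hbx hx
    have hKx := (hK x (Ioo_subset_Icc_self hx)).ne'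
    rw [← hbx]
    field_simp
  filter_upwards [hb, hprim] with x hbx hx
  rw [hbx]
  linarith [abs_add_le b (∫ s in (0 : ℝ)..x, F s)]

lemma integral_add_inv_mul_eq_zero (hκ : κ ≠ 0) (hwρ : IntegrableOn (fun x => w x * ρ x) (Ioo 0 1))
    (hgρ : IntegrableOn (fun x => g x * (x * ρ x)) (Ioo 0 1))
    (hmoment : κ * ∫ x in Ioo (0 : ℝ) 1, w x * ρ x = -∫ x in Ioo (0 : ℝ) 1, g x * (x * ρ x)) :
    ∫ x in Ioo (0 : ℝ) 1, (w x + κ⁻¹ * (x * g x)) * ρ x = 0 := by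
  have hsplit x : (w x + κ⁻¹ * (x * g x)) * ρ x = w x * ρ x + κ⁻¹ * (g x * (x * ρ x)) := by ring
  simp_rw [hsplit]
  rw [integral_add hwρ (hgρ.const_mul _), integral_const_mul, ← neg_eq_iff_eq_neg.2 hmoment,
    mul_neg, inv_mul_cancel_left₀ hκ, add_neg_cancel]

lemma ae_abs_le_of_moment (hρ : IntegrableOn ρ (Ioo 0 1)) (hρ0 : ∀ x ∈ Ioo (0 : ℝ) 1, 0 < ρ x)
    (hκ : 0 < κ) (hG : 0 ≤ G) (hw : IntegrableOn w (Ioo 0 1)) (hwg : HasWeakDeriv 1 w g)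
    (hg : MemLp g 2 vol01)
    (hgG : ∀ᵐ x ∂vol01, |g x| ≤ G)
    (hmoment : κ * ∫ x in Ioo (0 : ℝ) 1, w x * ρ x = -∫ x in Ioo (0 : ℝ) 1, g x * (x * ρ x)) :
    ∀ᵐ x ∂vol01, |w x| ≤ (2 + κ⁻¹) * G := by
  have hg1 := integrableOn_of_memLp hg
  obtain ⟨a, ha⟩ := hwg.exists_ae_eq_primitive hg1
  have hprim : ∀ x ∈ Ioo (0 : ℝ) 1, |∫ s in (0 : ℝ)..x, g s| ≤ G := fun x hx =>
    (abs_primitive_le_l2Norm hg hx).trans (l2Norm_le_of_ae_abs_le hG hgG)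
  have hxρ : IntegrableOn (fun x => x * ρ x) (Ioo 0 1) :=
    hρ.continuousOn_mul_of_subset continuousOn_id isCompact_Icc measurableSet_Ioo
      Ioo_subset_Icc_self
  have haG : |a| ≤ G + κ⁻¹ * G := by
    refine abs_le_of_integral_const_add_mul_eq_zero
      (h := fun x => (∫ s in (0 : ℝ)..x, g s) + κ⁻¹ * (x * g x)) hρ
      (ae_restrict_of_forall_mem measurableSet_Ioo fun x hx => (hρ0 x hx).le)
      (integral_pos_of_pos hρ hρ0) ?_ ?_ ?_
    · exact (aestronglyMeasurable_primitive hg1).add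
        ((aestronglyMeasurable_id.mul hg1.aestronglyMeasurable).const_mul _)
    · filter_upwards [hgG, ae_restrict_mem measurableSet_Ioo] with x hgx hx
      have hxg : |x * g x| ≤ G := by
        rw [abs_mul, abs_of_pos hx.1]
        exact (mul_le_of_le_one_left (abs_nonneg _) hx.2.le).trans hgx
      refine (abs_add_le _ _).trans (add_le_add (hprim x hx) ?_)
      rw [abs_mul, abs_of_pos (inv_pos.2 hκ)]
      exact mul_le_mul_of_nonneg_left hxg (inv_pos.2 hκ).le
    · refine (integral_congr_ae ?_).trans (integral_add_inv_mul_eq_zero hκ.ne'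
        (hρ.bdd_mul hw.aestronglyMeasurable (hwg.ae_abs_le hw hg))
        (hxρ.bdd_mul hg1.aestronglyMeasurable hgG) hmoment)
      filter_upwards [ha] with x hax
      rw [hax, add_assoc]
  filter_upwards [ha, ae_restrict_mem measurableSet_Ioo] with x hax hx
  rw [hax]
  linarith [abs_add_le a (∫ s in (0 : ℝ)..x, g s), hprim x hx]

lemma exists_apriori_bound (hβ : 0 < β) (hβ' : β < 1 / 2) (hθ : 0 ≤ θ) (hθ' : θ ≤ 1)
    (hKc : ContinuousOn K (Icc 0 1)) (hKm : 0 < Km) (hK : ∀ x ∈ Icc (0 : ℝ) 1, Km ≤ K x)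
    (hf : MemLp f 2 vol01) (h : IsWeakSolution β θ K f u) :
    ∃ g, HasWeakDeriv 1 (iTheta β θ u) g ∧ HasWeakDeriv 1 (fun x => K x * g x) (fun x => -f x) ∧
      (∀ᵐ x ∂vol01, |K x * g x| ≤ 2 * l2Norm f) ∧
      ∀ᵐ x ∂vol01, |iTheta β θ u x| ≤ (2 + (1 - β)⁻¹) * (2 / Km * l2Norm f) := by
  obtain ⟨ρ, hρ, hρ0, c, hc⟩ := exists_weight hβ hβ' hθ hθ'
  obtain ⟨g, hug, hg, hmean, hmoment⟩ :=
    h.1.exists_hasWeakDeriv_moments hβ (by linarith) hρ hc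
  have hflux := h.hasWeakDeriv_flux hKc (integrableOn_of_memLp hf) (integrableOn_of_memLp hg) hug
  have hρ1 := integrableOn_of_memLp hρ
  have hKg : ∀ᵐ x ∂vol01, |K x * g x| ≤ 2 * l2Norm f := by
    simpa only [l2Norm_neg] using
      ae_abs_flux_le hKc (fun x hx => hKm.trans_le (hK x hx)) hρ1 hρ0 hflux hf.neg hmean
  have hgG : ∀ᵐ x ∂vol01, |g x| ≤ 2 / Km * l2Norm f := by
    filter_upwards [hKg, ae_restrict_mem measurableSet_Ioo] with x hx hx01
    have hKx := hK x (Ioo_subset_Icc_self hx01)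
    rw [abs_mul, abs_of_pos (hKm.trans_le hKx)] at hx
    rw [div_mul_eq_mul_div, le_div_iff₀ hKm, mul_comm]
    exact (mul_le_mul_of_nonneg_right hKx (abs_nonneg _)).trans hx
  exact ⟨g, hug, hflux, hKg, ae_abs_le_of_moment hρ1 hρ0 (by linarith)
    (mul_nonneg (by positivity) (l2Norm_nonneg f))
    (integrableOn_iTheta hβ θ (integrableOn_of_memLp h.1.1)) hug hg hgG hmoment⟩

lemma exists_sobolevBound_iTheta (hβ : 0 < β) (hβ' : β < 1 / 2) (hθ : 0 ≤ θ) (hθ' : θ ≤ 1)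
    (m : ℕ) (hKm : 0 < Km) (hK : ∀ x ∈ Icc (0 : ℝ) 1, Km ≤ K x)
    (hKreg : ContDiffOn ℝ (m + 1 : ℕ) K (Icc 0 1)) :
    ∃ C, 0 ≤ C ∧ ∀ f u M, SobolevBound m f M → IsWeakSolution β θ K f u →
      SobolevBound (m + 2) (iTheta β θ u) (C * M) := by
  obtain ⟨C, hC, hmul⟩ := SobolevBound.exists_contDiffOn_mul (m + 1)
    (hKreg.inv fun x hx => (hKm.trans_le (hK x hx)).ne')
  have hβ1 : 0 < (1 - β)⁻¹ := inv_pos.2 (by linarith)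
  refine ⟨(2 + (1 - β)⁻¹) * (2 / Km) + C * 2, by positivity, fun f u M hf hu => ?_⟩
  obtain ⟨hf2, hfM⟩ := hf.memLp_and_l2Norm_le
  have hM := hf.nonneg
  obtain ⟨g, hug, hflux, hKg, hI⟩ :=
    exists_apriori_bound hβ hβ' hθ hθ' hKreg.continuousOn hKm hK hf2 hu
  have hKg2 : MemLp (fun x => K x * g x) 2 vol01 :=
    .of_bound hflux.1.aestronglyMeasurable _ hKg
  have hfluxBound : SobolevBound (m + 1) (fun x => K x * g x) (2 * M) :=
    .succ hKg2 (l2Norm_le_of_ae_abs_le (by positivity) (hKg.mono fun x hx => by linarith)) hflux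
      (hf.neg.mono (by linarith))
  have hgBound : SobolevBound (m + 1) g (C * (2 * M)) := by
    refine (hmul _ _ hfluxBound).congr ?_
    filter_upwards [ae_restrict_mem measurableSet_Ioo] with x hx
    exact inv_mul_cancel_left₀ (hKm.trans_le (hK x (Ioo_subset_Icc_self hx))).ne' _
  have hIM : (2 + (1 - β)⁻¹) * (2 / Km * l2Norm f) ≤ (2 + (1 - β)⁻¹) * (2 / Km) * M := by
    rw [← mul_assoc]
    exact mul_le_mul_of_nonneg_left hfM (by positivity)
  refine .succ (.of_bound hug.1.aestronglyMeasurable _ hI) ?_ hug (hgBound.mono ?_)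
  · refine l2Norm_le_of_ae_abs_le (by positivity) (hI.mono fun x hx => (hx.trans hIM).trans ?_)
    exact mul_le_mul_of_nonneg_right (le_add_of_nonneg_right (by positivity)) hM
  · rw [add_mul, mul_assoc C]
    exact le_add_of_nonneg_left (by positivity)

lemma cNorm_nonneg (n : ℕ) (K : ℝ → ℝ) : 0 ≤ cNorm n K :=
  Finset.sum_nonneg fun _ _ => Real.iSup_nonneg fun _ => abs_nonneg _

end WeakSolution

end FracDiff

theorem theorem6p5_general {β θ : ℝ} (hβ : 0 < β) (hβ' : β < 1 / 2) (hθ : 0 ≤ θ) (hθ' : θ ≤ 1)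
    (m : ℕ) {K : ℝ → ℝ} {Km : ℝ} (hKm : 0 < Km) (hK : ∀ x ∈ Ioo (0 : ℝ) 1, Km ≤ K x)
    (hKreg : ContDiffOn ℝ (m + 1 : ℕ) K (Icc 0 1)) :
    ∃ C : ℝ, 0 < C ∧ ∀ f u : ℝ → ℝ, MemH m f → IsWeakSolution β θ K f u →
      MemH (m + 2) (iTheta β θ u) ∧ hNorm (m + 2) (iTheta β θ u) ≤ C * hNorm m f := by
  have hKIcc : ∀ x ∈ Icc (0 : ℝ) 1, Km ≤ K x := fun x hx => by
    have hcl : x ∈ closure (Ioo (0 : ℝ) 1) := by rwa [closure_Ioo zero_ne_one]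
    exact ContinuousWithinAt.closure_le hcl continuousWithinAt_const
      ((hKreg.continuousOn x hx).mono Ioo_subset_Icc_self) hK
  obtain ⟨C, hC, hbound⟩ := exists_sobolevBound_iTheta hβ hβ' hθ hθ' m hKm hKIcc hKreg
  refine ⟨(m + 2 + 1) * (C + 1), by positivity, fun f u hf hu => ?_⟩
  have hI := (hbound f u _ hf.sobolevBound hu).mono
    (mul_le_mul_of_nonneg_right (lt_add_one C).le hf.sobolevBound.nonneg)
  refine ⟨hI.memH, hI.hNorm_le.trans_eq ?_⟩
  push_cast
  ring

theorem theorem6p5 (β θ : ℝ) (hβ : 0 < β) (hβ' : β < 1 / 2) (hθ : 0 ≤ θ) (hθ' : θ ≤ 1)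
    (m : ℕ) (K : ℝ → ℝ) (Km KM : ℝ) (hKm : 0 < Km)
    (hK : ∀ x ∈ Set.Ioo (0 : ℝ) 1, Km ≤ K x ∧ K x ≤ KM)
    (hKreg : ContDiffOn ℝ ((m + 1 : ℕ) : WithTop ℕ∞) K (Set.Icc 0 1))
    (hcond : SolvCond β θ K) :
    ∃ C : ℝ, 0 < C ∧ ∀ f u : ℝ → ℝ, MemH m f → IsWeakSolution β θ K f u →
      (MemH (m + 2) (iTheta β θ u) ∧
        hNorm (m + 2) (iTheta β θ u) ≤ C * (cNorm (m + 1) K + hNorm m f)) ∧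
      (HasWeakDeriv (m + 2) (iTheta β θ u) (weakDeriv (m + 2) (iTheta β θ u)) ∧
        MemLp (weakDeriv (m + 2) (iTheta β θ u)) 2 vol01 ∧
        l2Norm (weakDeriv (m + 2) (iTheta β θ u)) ≤ C * (cNorm (m + 1) K + hNorm m f)) := by
  obtain ⟨C, hC, h⟩ := theorem6p5_general hβ hβ' hθ hθ' m hKm (fun x hx => (hK x hx).1) hKreg
  refine ⟨C, hC, fun f u hf hu => ?_⟩
  obtain ⟨hI, hle⟩ := h f u hf hu
  have hle' := hle.trans (mul_le_mul_of_nonneg_left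
    (le_add_of_nonneg_left (cNorm_nonneg (m + 1) K)) hC.le)
  exact ⟨⟨hI, hle'⟩, hI.hasWeakDeriv le_rfl, hI.memLp_weakDeriv le_rfl,
    (l2Norm_weakDeriv_le_hNorm le_rfl _).trans hle'⟩
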